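/- **Theorem (Sample complexity upper bound for ICVaR-VI).** Let $\mathcal M=(\mathcal S,\mathcal A,\gamma,P,r)$ be a discounted Markov decision process with finite nonempty state and action spaces of sizes $S$ and $A$, discount factor $\gamma\in[0,1)$, transition kernel $P(\cdot\mid s,a)$ and deterministic rewards $r(s,a)\in[0,1]$. For $\tau\in(0,1]$ let $\mathrm{CVaR}_\tau(Z)=\sup_{x\in\mathbb R}\{x-\frac1\tau\mathbb E[(x-Z)_+]\}$. The iterated-CVaR value of a stationary (randomized) policy $\pi$ is $V^\pi(s)=\lim_n V^\pi_n(s)$, where $V^\pi_0=0$ and $$V^\pi_{n+1}(s)=\sum_a\pi(a\mid s)\,r(s,a)+\gamma\sum_a\pi(a\mid s)\,\mathrm{CVaR}_\tau\big(V^\pi_n(s')\big),\qquad s'\sim P(\cdot\mid s,a).$$ Let $V^*(s)=\sup_\pi V^\pi(s)$; a policy $\pi$ is $\varepsilon$-optimal if $V^*(s)-V^\pi(s)\le\varepsilon$ for all $s$. For every pair $(s,a)$ draw $N$ samples from $P(\cdot\mid s,a)$, all samples being independent, and let $\widehat P(\cdot\mid s,a)$ be their empirical distribution; the total number of samples is $SAN$.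 The algorithm ICVaR-VI with $T$ iterations computes $\widehat Q_0=0$ and $$\widehat Q_t(s,a)=r(s,a)+\gamma\,\mathrm{CVaR}_\tau\big(\max_{a'}\widehat Q_{t-1}(s',a')\big),\quad s'\sim\widehat P(\cdot\mid s,a),\quad t=1,\dots,T,$$ and returns a deterministic policy $\widehat\pi$ with $\widehat\pi(s)\in\arg\max_a\widehat Q_T(s,a)$ for all $s$. There is a universal constant $C>0$ such that for all such $\mathcal M$, all $\tau\in(0,1]$, $\varepsilon>0$, $\delta\in(0,1)$, and all $N,T$ with $T\ge\frac{C}{1-\gamma}\log\frac{2(1+1/\varepsilon)}{1-\gamma}$: 1. if $$SAN\;\ge\; C\,\frac{SA}{\tau^2(1-\gamma)^4\varepsilon^2}\,\log\frac{2SA(1+1/\varepsilon)}{\tau(1-\gamma)\delta},$$ then with probability at least $1-\delta$ the policy returned by ICVaR-VI is $\varepsilon$-optimal, however ties in the $\arg\max$ are broken; 2. if $\tau\ge\gamma$, the same conclusion already holds when $$SAN\;\ge\; C\,\frac{SA}{(1-\gamma)^3\varepsilon^2}\,\log\frac{2SA(1+1/\varepsilon)}{(1-\gamma)\delta}.$$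 -/

import Mathlib

open Filter MeasureTheory

noncomputable section

/-- Conditional value-at-risk at level `τ` of a random variable `Z` on a finite set whose
distribution has the weights `p`:
`CVaR_τ(Z) = sup_x { x - τ⁻¹ E[(x - Z)₊] }`. -/
def cvar {S : Type*} [Fintype S] (τ : ℝ) (p Z : S → ℝ) : ℝ :=
  ⨆ x : ℝ, (x - 1 / τ * ∑ s, p s * max (x - Z s) 0)

/-- An infinite-horizon discounted Markov decision process with discount factor in `[0, 1)`,
transition kernel `P` and deterministic rewards in `[0, 1]`. -/
structure MDP (S A : Type*) where
  γ : ℝ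
  γ_nonneg : 0 ≤ γ
  γ_lt_one : γ < 1
  P : S → A → PMF S
  r : S → A → ℝ
  r_nonneg : ∀ s a, 0 ≤ r s a
  r_le_one : ∀ s a, r s a ≤ 1

/-- The value `max_a Q(s, a)` of a Q-function. -/
def maxQ {S A : Type*} (Q : S → A → ℝ) (s : S) : ℝ := ⨆ a, Q s a

/-- One update of iterated CVaR value iteration, for the transition weights `p`, the rewards `r`
and the discount factor `γ`:
`Q ↦ ((s, a) ↦ r(s, a) + γ CVaR_τ^{s' ∼ p(· | s, a)}(max_{a'} Q(s', a')))`. -/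
def cvarBellman {S A : Type*} [Fintype S] (τ γ : ℝ) (r : S → A → ℝ) (p : S → A → S → ℝ)
    (Q : S → A → ℝ) : S → A → ℝ :=
  fun s a => r s a + γ * cvar τ (p s a) (maxQ Q)

/-- The Q-function computed by `T` iterations of ICVaR-VI, started at `0`. -/
def icvarVI {S A : Type*} [Fintype S] (τ γ : ℝ) (r : S → A → ℝ) (p : S → A → S → ℝ) :
    ℕ → S → A → ℝ
  | 0 => fun _ _ => 0
  | T + 1 => cvarBellman τ γ r p (icvarVI τ γ r p T)

/-- `π(s) ∈ argmax_a Q(s, a)` for every state `s`. -/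
def IsGreedy {S A : Type*} (Q : S → A → ℝ) (π : S → A) : Prop :=
  ∀ s a, Q s a ≤ Q s (π s)

/-- The empirical transition kernel of `N` sampled next states for each state-action pair:
`P̂(s' | s, a) = N⁻¹ #{i | ω(s, a, i) = s'}`. -/
def empiricalKernel {S A : Type*} [DecidableEq S] {N : ℕ} (ω : S × A × Fin N → S)
    (s : S) (a : A) (s' : S) : ℝ :=
  1 / N * ∑ i : Fin N, if ω (s, a, i) = s' then 1 else 0

namespace MDP

variable {S A : Type*} [Fintype S] [Fintype A]

/-- The transition probability `P(s' | s, a)` as a real number. -/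
def prob (M : MDP S A) (s : S) (a : A) (s' : S) : ℝ := (M.P s a s').toReal

/-- The `n`-fold nested iterated CVaR of a stationary randomized policy `π`:
`r(s₀, π) + γ CVaR_{s₀, π}(r(s₁, π) + γ CVaR_{s₁, π}(⋯ r(s_{n-1}, π) ⋯))`, where
`r(s, π) = ∑_a π(a | s) r(s, a)` and
`CVaR_{s, π}(Z) = ∑_a π(a | s) CVaR_τ^{s' ∼ P(· | s, a)}(Z(s'))`. -/
def nestedValue (M : MDP S A) (τ : ℝ) (π : S → PMF A) : ℕ → S → ℝ
  | 0 => fun _ => 0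
  | n + 1 => fun s => ∑ a, (π s a).toReal * M.r s a +
      M.γ * ∑ a, (π s a).toReal * cvar τ (M.prob s a) (nestedValue M τ π n)

/-- The iterated CVaR value function `V^π` of a stationary randomized policy: the limit of the
nested values. The limit exists, see `MDP.tendsto_nestedValue`. -/
def value (M : MDP S A) (τ : ℝ) (π : S → PMF A) (s : S) : ℝ :=
  limUnder atTop fun n => M.nestedValue τ π n s

/-- The optimal iterated CVaR value `V^*(s) = sup_π V^π(s)`. -/
def optValue (M : MDP S A) (τ : ℝ) (s : S) : ℝ := ⨆ π : S → PMF A, M.value τ π s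

/-- `π` is `ε`-optimal: `V^*(s) - V^π(s) ≤ ε` for every state `s`. -/
def IsEpsOptimal (M : MDP S A) (τ ε : ℝ) (π : S → PMF A) : Prop :=
  ∀ s, M.optValue τ s - M.value τ π s ≤ ε

/-- The law of the data of the generative model: `N` samples of the next state for each
state-action pair, all independent, those for `(s, a)` distributed as `P(· | s, a)`. -/
def sampleLaw [MeasurableSpace S] (M : MDP S A) (N : ℕ) : Measure (S × A × Fin N → S) :=
  Measure.pi fun k => (M.P k.1 k.2.1).toMeasure

/-- The probability that ICVaR-VI, run for `T` iterations on the empirical kernel of `N` samples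
per state-action pair, returns an `ε`-optimal policy, whichever maximizing actions it selects. -/
def successProb [DecidableEq S] [MeasurableSpace S] (M : MDP S A) (τ ε : ℝ) (N T : ℕ) : ℝ :=
  (M.sampleLaw N).real {ω | ∀ π : S → A,
    IsGreedy (icvarVI τ M.γ M.r (empiricalKernel ω) T) π →
      M.IsEpsOptimal τ ε fun s => PMF.pure (π s)}

/-- The total number of samples, `N` for each state-action pair. -/
def numSamples (_M : MDP S A) (N : ℕ) : ℕ := Fintype.card S * Fintype.card A * N

end MDP

theorem pmf_sum_toReal {S : Type*} [Fintype S] (p : PMF S) : ∑ s, (p s).toReal = 1 := by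
  rw [← ENNReal.toReal_sum (fun s _ => p.apply_ne_top s), ← tsum_fintype (L := .unconditional S),
    p.tsum_coe]
  rfl

theorem cvar_term_le {S : Type*} [Fintype S] {τ : ℝ} (h0 : 0 < τ) (h1 : τ ≤ 1) {p : S → ℝ}
    (hp : ∀ s, 0 ≤ p s) (hs : ∑ s, p s = 1) (Z : S → ℝ) (x : ℝ) :
    x - 1 / τ * ∑ s, p s * max (x - Z s) 0 ≤ ∑ s, p s * Z s := by
  have a : ∑ s, p s * (x - Z s) ≤ ∑ s, p s * max (x - Z s) 0 :=
    Finset.sum_le_sum fun s _ => mul_le_mul_of_nonneg_left (le_max_left _ _) (hp s)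
  have b : ∑ s, p s * (x - Z s) = x - ∑ s, p s * Z s := by
    simp only [mul_sub, Finset.sum_sub_distrib, ← Finset.sum_mul, hs, one_mul]
  have c : 0 ≤ ∑ s, p s * max (x - Z s) 0 :=
    Finset.sum_nonneg fun s _ => mul_nonneg (hp s) (le_max_right _ _)
  have d : 1 ≤ 1 / τ := by rw [le_div_iff₀ h0]; linarith
  nlinarith

theorem cvar_le_mean {S : Type*} [Fintype S] {τ : ℝ} (h0 : 0 < τ) (h1 : τ ≤ 1) {p : S → ℝ}
    (hp : ∀ s, 0 ≤ p s) (hs : ∑ s, p s = 1) (Z : S → ℝ) :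
    cvar τ p Z ≤ ∑ s, p s * Z s :=
  ciSup_le fun x => cvar_term_le h0 h1 hp hs Z x

theorem cvar_bddAbove {S : Type*} [Fintype S] {τ : ℝ} (h0 : 0 < τ) (h1 : τ ≤ 1) {p : S → ℝ}
    (hp : ∀ s, 0 ≤ p s) (hs : ∑ s, p s = 1) (Z : S → ℝ) :
    BddAbove (Set.range fun x : ℝ => x - 1 / τ * ∑ s, p s * max (x - Z s) 0) :=
  ⟨∑ s, p s * Z s, by rintro _ ⟨x, rfl⟩; exact cvar_term_le h0 h1 hp hs Z x⟩

theorem cvar_mono {S : Type*} [Fintype S] {τ : ℝ} (h0 : 0 < τ) (h1 : τ ≤ 1) {p : S → ℝ}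
    (hp : ∀ s, 0 ≤ p s) (hs : ∑ s, p s = 1) {Z W : S → ℝ} (h : ∀ s, Z s ≤ W s) :
    cvar τ p Z ≤ cvar τ p W := by
  refine ciSup_mono (cvar_bddAbove h0 h1 hp hs W) fun x => ?_
  have : ∑ s, p s * max (x - W s) 0 ≤ ∑ s, p s * max (x - Z s) 0 :=
    Finset.sum_le_sum fun s _ => mul_le_mul_of_nonneg_left
      (max_le_max (by linarith [h s]) le_rfl) (hp s)
  have := mul_le_mul_of_nonneg_left this (one_div_nonneg.2 h0.le)
  linarith

theorem cvar_nonneg {S : Type*} [Fintype S] {τ : ℝ} (h0 : 0 < τ) (h1 : τ ≤ 1) {p : S → ℝ}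
    (hp : ∀ s, 0 ≤ p s) (hs : ∑ s, p s = 1) {Z : S → ℝ} (h : ∀ s, 0 ≤ Z s) :
    0 ≤ cvar τ p Z := by
  refine le_ciSup_of_le (cvar_bddAbove h0 h1 hp hs Z) 0 ?_
  simp [h]

namespace MDP

variable {S A : Type*} [Fintype S] [Fintype A]

theorem nestedValue_mem (M : MDP S A) {τ : ℝ} (h0 : 0 < τ) (h1 : τ ≤ 1) (π : S → PMF A) (n : ℕ) :
    ∀ s, 0 ≤ M.nestedValue τ π n s ∧
      M.nestedValue τ π n s ≤ M.nestedValue τ π (n + 1) s ∧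
      M.nestedValue τ π n s ≤ 1 / (1 - M.γ) := by
  have hγ := M.γ_nonneg
  have hγ' : 0 < 1 - M.γ := by linarith [M.γ_lt_one]
  have hp : ∀ s a s', 0 ≤ M.prob s a s' := fun _ _ _ => ENNReal.toReal_nonneg
  have hs : ∀ s a, ∑ s', M.prob s a s' = 1 := fun s a => pmf_sum_toReal (M.P s a)
  have hπ : ∀ s a, 0 ≤ (π s a).toReal := fun _ _ => ENNReal.toReal_nonneg
  have key : ∀ Z : S → ℝ, (∀ s, 0 ≤ Z s) → ∀ s, 0 ≤ ∑ a, (π s a).toReal * M.r s a +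
      M.γ * ∑ a, (π s a).toReal * cvar τ (M.prob s a) Z := fun Z hZ s =>
    add_nonneg (Finset.sum_nonneg fun a _ => mul_nonneg (hπ s a) (M.r_nonneg s a))
      (mul_nonneg hγ (Finset.sum_nonneg fun a _ => mul_nonneg (hπ s a)
        (cvar_nonneg h0 h1 (hp s a) (hs s a) hZ)))
  induction n with
  | zero =>
    intro s
    refine ⟨le_rfl, key _ (fun _ => le_rfl) s, ?_⟩
    exact one_div_nonneg.2 hγ'.le
  | succ n ih =>
    intro s
    refine ⟨key _ (fun s => (ih s).1) s, ?_, ?_⟩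
    · have : ∑ a, (π s a).toReal * cvar τ (M.prob s a) (M.nestedValue τ π n) ≤
          ∑ a, (π s a).toReal * cvar τ (M.prob s a) (M.nestedValue τ π (n + 1)) :=
        Finset.sum_le_sum fun a _ => mul_le_mul_of_nonneg_left
          (cvar_mono h0 h1 (hp s a) (hs s a) fun s => (ih s).2.1) (hπ s a)
      have := mul_le_mul_of_nonneg_left this hγ
      change _ + _ ≤ _ + _
      linarith
    · have b1 : ∑ a, (π s a).toReal * M.r s a ≤ 1 := by
        rw [← pmf_sum_toReal (π s)]
        exact Finset.sum_le_sum fun a _ => mul_le_of_le_one_right (hπ s a) (M.r_le_one s a)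
      have b2 : ∀ a, cvar τ (M.prob s a) (M.nestedValue τ π n) ≤ 1 / (1 - M.γ) := fun a => by
        refine (cvar_le_mean h0 h1 (hp s a) (hs s a) _).trans ?_
        refine (Finset.sum_le_sum fun s' _ => mul_le_mul_of_nonneg_left (ih s').2.2
          (hp s a s')).trans ?_
        rw [← Finset.sum_mul, hs, one_mul]
      have b3 : ∑ a, (π s a).toReal * cvar τ (M.prob s a) (M.nestedValue τ π n) ≤
          1 / (1 - M.γ) := by
        refine (Finset.sum_le_sum fun a _ => mul_le_mul_of_nonneg_left (b2 a) (hπ s a)).trans ?_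
        rw [← Finset.sum_mul, pmf_sum_toReal, one_mul]
      have b4 : 1 / (1 - M.γ) = 1 + M.γ * (1 / (1 - M.γ)) := by field_simp; ring
      have := mul_le_mul_of_nonneg_left b3 hγ
      change _ + _ ≤ _
      linarith

/-- The limit that defines the value function exists. -/
theorem tendsto_nestedValue (M : MDP S A) {τ : ℝ} (h0 : 0 < τ) (h1 : τ ≤ 1) (π : S → PMF A)
    (s : S) : Tendsto (fun n => M.nestedValue τ π n s) atTop (nhds (M.value τ π s)) :=
  tendsto_nhds_limUnder ⟨_, tendsto_atTop_ciSup
    (monotone_nat_of_le_succ fun n => (M.nestedValue_mem h0 h1 π n s).2.1)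
    ⟨1 / (1 - M.γ), by rintro _ ⟨n, rfl⟩; exact (M.nestedValue_mem h0 h1 π n s).2.2⟩⟩

end MDP

end

/-! Write `H = 1 / (1 - γ)`, and let `V` be the value computed from the empirical kernel after a
large number of iterations. The analysis separates a statistical bound on the error in the CVaR of
`V` from a deterministic propagation of that error through the Bellman recursion.

Statistics. Since `V` depends on all samples, concentration does not apply to it directly. For each
pair `(s, a)`, the iteration is rerun with the entry at `(s, a)` frozen at a grid value `u`
(`pinnedVI`). The result does not depend on the samples at `(s, a)`, and it is close to `V` once `u`
is close to the true entry (`abs_icvarVI_sub_pinnedVI_le`). The supremum defining CVaR is attained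
at a value of the random variable (`exists_cvar_eq`), so finitely many shortfalls `(W t - W)₊` need
control. A Bernstein bound with a fixed exponential parameter `l`, together with a union bound over
pairs, thresholds, grid points and signs, yields an error `(2 l Var_P(V) + L / (l N) + 16 η) / τ`
(`sampleLaw_cvar_error`).

Propagation. CVaR is the minimum of the means under weights `q` with `τ q ≤ P`, so along suitably
chosen `q` the recursion is that of an ordinary Markov chain. An error of the form `κ γ Var_q(V) +
b` need not be charged at its worst value in every step: `γ Var_q(V)` is bounded by an increment of
`V²` plus a multiple of the Bellman defect (`mul_weightedVar_le`). Adding a multiple of `V²` to the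
quantity under induction makes these terms telescope, so the variance costs `κ H²` in total instead
of `κ H³` (`sub_value_pure_le`, `value_sub_le`).

The two regimes. In general `Var_P(V) ≤ H²` is used with `κ = 0`, which gives `τ⁻² H⁴ ε⁻²`. If `τ ≥
γ`, every admissible `q` carries all but mass `1 - τ ≤ 1 - γ` of `P`, hence `(γ / τ) Var_P(V) ≤ γ
Var_q(V) + H`; telescoping then gives `H³ ε⁻²`. -/

/-- The variance of `Z` under the weights `p`. -/
noncomputable def weightedVar {S : Type*} [Fintype S] (p Z : S → ℝ) : ℝ :=
  ∑ s, p s * (Z s - ∑ t, p t * Z t) ^ 2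

/-! ### Means and variances under finite weights -/

section Weights

variable {S : Type*} [Fintype S]

theorem sum_weights_mul_sub_sq (p Z : S → ℝ) (hs : ∑ s, p s = 1) (m : ℝ) :
    ∑ s, p s * (Z s - m) ^ 2 = weightedVar p Z + (∑ t, p t * Z t - m) ^ 2 := by
  unfold weightedVar
  set μ := ∑ t, p t * Z t with hμ
  have h : ∀ c : ℝ, ∑ s, p s * (Z s - c) ^ 2 = ∑ s, p s * Z s ^ 2 - 2 * c * μ + c ^ 2 := by
    intro c
    have : ∀ s, p s * (Z s - c) ^ 2 = p s * Z s ^ 2 - 2 * c * (p s * Z s) + c ^ 2 * p s := by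
      intro s; ring
    simp only [this, Finset.sum_add_distrib, Finset.sum_sub_distrib, ← Finset.mul_sum, hs, ← hμ]
    ring
  rw [h, h]; ring

theorem weightedVar_eq (p Z : S → ℝ) (hs : ∑ s, p s = 1) :
    weightedVar p Z = ∑ s, p s * Z s ^ 2 - (∑ t, p t * Z t) ^ 2 := by
  have := sum_weights_mul_sub_sq p Z hs 0
  simp only [sub_zero] at this
  linarith

theorem weightedVar_le (p Z : S → ℝ) (hs : ∑ s, p s = 1) (m : ℝ) :
    weightedVar p Z ≤ ∑ s, p s * (Z s - m) ^ 2 := by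
  rw [sum_weights_mul_sub_sq p Z hs]; nlinarith [sq_nonneg (∑ t, p t * Z t - m)]

theorem weighted_le {p : S → ℝ} (hp : ∀ s, 0 ≤ p s) (hs : ∑ s, p s = 1) {Z : S → ℝ} {c : ℝ}
    (h : ∀ s, Z s ≤ c) : ∑ s, p s * Z s ≤ c := by
  calc ∑ s, p s * Z s ≤ ∑ s, p s * c :=
        Finset.sum_le_sum fun s _ => mul_le_mul_of_nonneg_left (h s) (hp s)
    _ = c := by rw [← Finset.sum_mul, hs, one_mul]

theorem le_weighted {p : S → ℝ} (hp : ∀ s, 0 ≤ p s) (hs : ∑ s, p s = 1) {Z : S → ℝ} {c : ℝ}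
    (h : ∀ s, c ≤ Z s) : c ≤ ∑ s, p s * Z s := by
  calc c = ∑ s, p s * c := by rw [← Finset.sum_mul, hs, one_mul]
    _ ≤ _ := Finset.sum_le_sum fun s _ => mul_le_mul_of_nonneg_left (h s) (hp s)

theorem weightedVar_le_sq {p : S → ℝ} (hp : ∀ s, 0 ≤ p s) (hs : ∑ s, p s = 1) {Z : S → ℝ} {H : ℝ}
    (h0 : ∀ s, 0 ≤ Z s) (h1 : ∀ s, Z s ≤ H) : weightedVar p Z ≤ H ^ 2 := by
  refine (weightedVar_le p Z hs 0).trans (weighted_le hp hs fun s => ?_)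
  rw [sub_zero]
  exact pow_le_pow_left₀ (h0 s) (h1 s) 2

/-- If `|W' - W| ≤ η` then the variance of the shortfall `(W'(s₀) - W')₊` is controlled by the
variance of `W`. -/
theorem weightedVar_shortfall_le {p : S → ℝ} (hp : ∀ s, 0 ≤ p s) (hs : ∑ s, p s = 1)
    {W W' : S → ℝ} {η : ℝ} (h : ∀ s, |W s - W' s| ≤ η) (x : ℝ) :
    weightedVar p (fun s => max (x - W' s) 0) ≤ 2 * weightedVar p W + 2 * η ^ 2 := by
  set m := ∑ t, p t * W t with hm
  -- The variance is at most the second moment about any point; centring at the shortfall of the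
  -- mean lets the 1-Lipschitz map `y ↦ (x - y)₊` be applied pointwise.
  refine (weightedVar_le p _ hs (max (x - m) 0)).trans ?_
  have key : ∀ s, p s * (max (x - W' s) 0 - max (x - m) 0) ^ 2
      ≤ 2 * (p s * (W s - m) ^ 2) + 2 * η ^ 2 * p s := by
    intro s
    have h1 : |max (x - W' s) 0 - max (x - m) 0| ≤ |W s - m| + η := by
      refine (abs_max_sub_max_le_abs _ _ _).trans ?_
      have := h s
      calc |x - W' s - (x - m)| = |(W s - W' s) - (W s - m)| := by congr 1; ring
        _ ≤ |W s - W' s| + |W s - m| := abs_sub _ _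
        _ ≤ _ := by linarith
    have h2 : (max (x - W' s) 0 - max (x - m) 0) ^ 2 ≤ 2 * (W s - m) ^ 2 + 2 * η ^ 2 := by
      rw [← sq_abs]
      have := pow_le_pow_left₀ (abs_nonneg _) h1 2
      rw [← sq_abs (W s - m)]
      nlinarith [sq_nonneg (|W s - m| - η)]
    nlinarith [mul_le_mul_of_nonneg_left h2 (hp s)]
  refine (Finset.sum_le_sum fun s _ => key s).trans ?_
  rw [Finset.sum_add_distrib, ← Finset.mul_sum, ← Finset.mul_sum, hs, mul_one]
  rfl

/-- Weights dominated by `p / τ` have variance comparable to that of `p`, up to the mass `1 - τ`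
that they may leave out. -/
theorem weightedVar_le_of_dominated {τ : ℝ} {p q : S → ℝ}
    (hs : ∑ s, p s = 1) (hq : ∀ s, 0 ≤ q s) (hqp : ∀ s, τ * q s ≤ p s) (hqs : ∑ s, q s = 1)
    {Z : S → ℝ} {H : ℝ} (h0 : ∀ s, 0 ≤ Z s) (h1 : ∀ s, Z s ≤ H) :
    weightedVar p Z ≤ τ * weightedVar q Z + (1 - τ) * H ^ 2 := by
  set m := ∑ t, q t * Z t with hm
  have hm0 : 0 ≤ m := le_weighted hq hqs h0
  have hm1 : m ≤ H := weighted_le hq hqs h1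
  refine (weightedVar_le p Z hs m).trans ?_
  -- The remainder `p - τ q` is nonnegative of total mass `1 - τ`, and on it the squared deviation
  -- from the `q`-mean is at most `H²`.
  have key : ∀ s, p s * (Z s - m) ^ 2 ≤
      τ * (q s * (Z s - m) ^ 2) + (p s * H ^ 2 - τ * (q s * H ^ 2)) := by
    intro s
    have : (Z s - m) ^ 2 ≤ H ^ 2 := by
      apply sq_le_sq'
      · linarith [h0 s]
      · linarith [h1 s]
    nlinarith [mul_le_mul_of_nonneg_left this (sub_nonneg.2 (hqp s))]
  refine (Finset.sum_le_sum fun s _ => key s).trans ?_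
  rw [Finset.sum_add_distrib, Finset.sum_sub_distrib, ← Finset.mul_sum, ← Finset.mul_sum,
    ← Finset.sum_mul, ← Finset.sum_mul, hs, hqs]
  unfold weightedVar
  linarith

end Weights

/-! ### Duality and stability of CVaR -/

section CVaR

variable {S : Type*} [Fintype S] {τ : ℝ} {p : S → ℝ}

/-- Weak duality: CVaR is at most the mean under any weights dominated by `p / τ`. -/
theorem cvar_le_of_dominated (h0 : 0 < τ) {q : S → ℝ} (hq : ∀ s, 0 ≤ q s)
    (hqp : ∀ s, τ * q s ≤ p s) (hqs : ∑ s, q s = 1) (Z : S → ℝ) :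
    cvar τ p Z ≤ ∑ s, q s * Z s := by
  refine ciSup_le fun x => ?_
  have key : ∀ s, q s * x - q s * Z s ≤ 1 / τ * (p s * max (x - Z s) 0) := by
    intro s
    have h1 : q s * (x - Z s) ≤ q s * max (x - Z s) 0 :=
      mul_le_mul_of_nonneg_left (le_max_left _ _) (hq s)
    have h2 : q s ≤ 1 / τ * p s := by
      rw [one_div, ← div_eq_inv_mul, le_div_iff₀ h0]; linarith [hqp s]
    have h3 := mul_le_mul_of_nonneg_right h2 (le_max_right (x - Z s) 0)
    linarith
  have := Finset.sum_le_sum fun s (_ : s ∈ Finset.univ) => key s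
  rw [Finset.sum_sub_distrib, ← Finset.sum_mul, hqs, ← Finset.mul_sum] at this
  linarith

/-- The lower `τ`-quantile of a function on a finite set. -/
theorem exists_quantile (h0 : 0 < τ) (h1 : τ ≤ 1) (hs : ∑ s, p s = 1) (Z : S → ℝ) :
    ∃ s₀, ∑ s with Z s < Z s₀, p s < τ ∧ τ ≤ ∑ s with Z s ≤ Z s₀, p s := by
  classical
  have hne : Nonempty S := by
    by_contra h
    rw [not_nonempty_iff] at h
    simp at hs
  set F : Finset S := {s | τ ≤ ∑ t with Z t ≤ Z s, p t} with hF
  have hFne : F.Nonempty := by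
    obtain ⟨s, hs'⟩ := Finite.exists_max Z
    refine ⟨s, ?_⟩
    simp [hF, hs', hs, h1]
  obtain ⟨s₀, hs₀, hmin⟩ := F.exists_min_image Z hFne
  refine ⟨s₀, ?_, by simpa [hF] using hs₀⟩
  -- Otherwise the largest value strictly below `Z s₀` already has cumulative mass at least `τ`,
  -- against the minimality of `Z s₀`.
  by_contra! hcon
  set G : Finset S := {s | Z s < Z s₀} with hG
  have hGne : G.Nonempty := by
    rw [Finset.nonempty_iff_ne_empty]
    intro h
    rw [h] at hcon
    simp at hcon
    linarith
  obtain ⟨s₁, hs₁, hmax⟩ := G.exists_max_image Z hGne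
  have hlt : Z s₁ < Z s₀ := by simpa [hG] using hs₁
  have heq : G = ({s | Z s ≤ Z s₁} : Finset S) := by
    ext s
    simp only [hG, Finset.mem_filter_univ]
    refine ⟨fun h => hmax s (by simpa [hG] using h), fun h => h.trans_lt hlt⟩
  have : s₁ ∈ F := by simpa [hF, ← heq] using hcon
  exact absurd (hmin s₁ this) (not_le.2 hlt)

/-- The supremum defining CVaR is attained at a value of `Z`, and the dual problem has a
minimizer. -/
theorem exists_cvar_eq (h0 : 0 < τ) (h1 : τ ≤ 1) (hp : ∀ s, 0 ≤ p s) (hs : ∑ s, p s = 1)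
    (Z : S → ℝ) : ∃ s₀, ∃ q : S → ℝ, (∀ s, 0 ≤ q s) ∧ (∀ s, τ * q s ≤ p s) ∧ ∑ s, q s = 1 ∧
      cvar τ p Z = Z s₀ - 1 / τ * ∑ s, p s * max (Z s₀ - Z s) 0 ∧
      cvar τ p Z = ∑ s, q s * Z s := by
  classical
  obtain ⟨s₀, ha, hab⟩ := exists_quantile h0 h1 hs Z
  set a := ∑ s with Z s < Z s₀, p s with ha'
  set b := ∑ s with Z s = Z s₀, p s with hb'
  have hsplit : ∑ s with Z s ≤ Z s₀, p s = a + b := by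
    rw [ha', hb', Finset.sum_filter, Finset.sum_filter, Finset.sum_filter,
      ← Finset.sum_add_distrib]
    refine Finset.sum_congr rfl fun s _ => ?_
    rcases lt_trichotomy (Z s) (Z s₀) with h | h | h
    · simp [h, h.le, h.ne]
    · simp [h]
    · simp [h.not_ge, h.not_gt, h.ne']
  have hb : 0 < b := by linarith
  -- The worst tail: all of `p / τ` below the quantile, and the fraction `(τ - a) / b` of the atom
  -- at the quantile, which brings the total mass to 1. Its mean equals the primal objective at `Z
  -- s₀`, so weak duality forces both to equal CVaR.
  set q : S → ℝ := fun s => (if Z s < Z s₀ then p s else 0) / τ +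
    (τ - a) / b / τ * (if Z s = Z s₀ then p s else 0) with hq
  have hθ0 : 0 ≤ (τ - a) / b := div_nonneg (by linarith) hb.le
  have hθ1 : (τ - a) / b ≤ 1 := by rw [div_le_one hb]; linarith
  have hq0 : ∀ s, 0 ≤ q s := by
    intro s
    have := hp s
    simp only [hq]
    split_ifs <;> positivity
  have hqp : ∀ s, τ * q s ≤ p s := by
    intro s
    have hps := hp s
    have e : τ * q s = (if Z s < Z s₀ then p s else 0) +
        (τ - a) / b * (if Z s = Z s₀ then p s else 0) := by
      simp only [hq]; field_simp
    rw [e]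
    rcases lt_trichotomy (Z s) (Z s₀) with h | h | h
    · simp [h, h.ne]
    · simp only [h, lt_irrefl, if_true, if_false, zero_add]
      exact mul_le_of_le_one_left hps hθ1
    · simp [h.not_gt, h.ne', hps]
  have hqs : ∑ s, q s = 1 := by
    simp only [hq]
    rw [Finset.sum_add_distrib, ← Finset.sum_div, ← Finset.mul_sum, ← Finset.sum_filter,
      ← Finset.sum_filter, ← ha', ← hb']
    field_simp
    ring
  have hval : Z s₀ - 1 / τ * ∑ s, p s * max (Z s₀ - Z s) 0 = ∑ s, q s * Z s := by
    have : ∀ s, q s * Z s = q s * Z s₀ - 1 / τ * (p s * max (Z s₀ - Z s) 0) := by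
      intro s
      simp only [hq]
      rcases lt_trichotomy (Z s) (Z s₀) with h | h | h
      · rw [max_eq_left (by linarith)]
        simp [h, h.ne]
        ring
      · simp [h]
      · rw [max_eq_right (by linarith)]
        simp [h.not_gt, h.ne']
    simp only [this]
    rw [Finset.sum_sub_distrib, ← Finset.sum_mul, hqs, ← Finset.mul_sum]
    ring
  have hle := cvar_le_of_dominated h0 hq0 hqp hqs Z
  have hge : Z s₀ - 1 / τ * ∑ s, p s * max (Z s₀ - Z s) 0 ≤ cvar τ p Z :=
    le_ciSup (f := fun x : ℝ => x - 1 / τ * ∑ s, p s * max (x - Z s) 0)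
      (cvar_bddAbove h0 h1 hp hs Z) (Z s₀)
  exact ⟨s₀, q, hq0, hqp, hqs, by linarith, by linarith⟩

/-- The weights minimizing the dual problem for `W` are admissible for `Z` and have mass one. This
is what makes the Bellman update a `γ`-contraction. -/
theorem cvar_le_add (h0 : 0 < τ) (h1 : τ ≤ 1) (hp : ∀ s, 0 ≤ p s) (hs : ∑ s, p s = 1)
    {Z W : S → ℝ} {d : ℝ} (h : ∀ s, Z s ≤ W s + d) : cvar τ p Z ≤ cvar τ p W + d := by
  obtain ⟨-, q, hq0, hqp, hqs, -, hq⟩ := exists_cvar_eq h0 h1 hp hs W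
  refine (cvar_le_of_dominated h0 hq0 hqp hqs Z).trans ?_
  rw [hq]
  calc ∑ s, q s * Z s ≤ ∑ s, q s * (W s + d) :=
        Finset.sum_le_sum fun s _ => mul_le_mul_of_nonneg_left (h s) (hq0 s)
    _ = _ := by simp only [mul_add, Finset.sum_add_distrib, ← Finset.sum_mul, hqs, one_mul]

theorem cvar_le_of_le (h0 : 0 < τ) (h1 : τ ≤ 1) (hp : ∀ s, 0 ≤ p s) (hs : ∑ s, p s = 1)
    {Z : S → ℝ} {c : ℝ} (h : ∀ s, Z s ≤ c) : cvar τ p Z ≤ c :=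
  (cvar_le_mean h0 h1 hp hs Z).trans (weighted_le hp hs h)

/-- The effect of a change of weights on CVaR, in terms of the shortfalls below values of `Z`. -/
theorem abs_cvar_sub_cvar_le (h0 : 0 < τ) (h1 : τ ≤ 1) (hp : ∀ s, 0 ≤ p s) (hs : ∑ s, p s = 1)
    {p' : S → ℝ} (hp' : ∀ s, 0 ≤ p' s) (hs' : ∑ s, p' s = 1) (Z : S → ℝ) {e : ℝ}
    (he : ∀ s₀, |∑ s, p' s * max (Z s₀ - Z s) 0 - ∑ s, p s * max (Z s₀ - Z s) 0| ≤ e) :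
    |cvar τ p' Z - cvar τ p Z| ≤ 1 / τ * e := by
  have hτ : 0 ≤ 1 / τ := one_div_nonneg.2 h0.le
  -- The maximizer for each set of weights is a competitor in the other supremum.
  obtain ⟨s₀, -, -, -, -, hv, -⟩ := exists_cvar_eq h0 h1 hp hs Z
  obtain ⟨s₁, -, -, -, -, hv', -⟩ := exists_cvar_eq h0 h1 hp' hs' Z
  have g : Z s₁ - 1 / τ * ∑ s, p s * max (Z s₁ - Z s) 0 ≤ cvar τ p Z :=
    le_ciSup (f := fun x : ℝ => x - 1 / τ * ∑ s, p s * max (x - Z s) 0)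
      (cvar_bddAbove h0 h1 hp hs Z) (Z s₁)
  have g' : Z s₀ - 1 / τ * ∑ s, p' s * max (Z s₀ - Z s) 0 ≤ cvar τ p' Z :=
    le_ciSup (f := fun x : ℝ => x - 1 / τ * ∑ s, p' s * max (x - Z s) 0)
      (cvar_bddAbove h0 h1 hp' hs' Z) (Z s₀)
  have e0 := mul_le_mul_of_nonneg_left (abs_le.1 (he s₀)).2 hτ
  have e1 := mul_le_mul_of_nonneg_left (abs_le.1 (he s₁)).1 hτ
  rw [abs_le]
  constructor <;> linarith

end CVaR

/-! ### Contraction of value iteration and the pinned iteration -/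

section MaxQ

variable {S A : Type*}

theorem maxQ_le [Nonempty A] {Q : S → A → ℝ} {s : S} {c : ℝ} (h : ∀ a, Q s a ≤ c) :
    maxQ Q s ≤ c := ciSup_le h

variable [Finite A]

theorem le_maxQ (Q : S → A → ℝ) (s : S) (a : A) : Q s a ≤ maxQ Q s :=
  le_ciSup (f := fun a => Q s a) (Set.finite_range _).bddAbove a

theorem maxQ_le_add [Nonempty A] {Q Q' : S → A → ℝ} {d : ℝ} (h : ∀ s a, Q s a ≤ Q' s a + d)
    (s : S) : maxQ Q s ≤ maxQ Q' s + d :=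
  maxQ_le fun a => (h s a).trans (by linarith [le_maxQ Q' s a])

theorem maxQ_nonneg [Nonempty A] {Q : S → A → ℝ} (h : ∀ s a, 0 ≤ Q s a) (s : S) :
    0 ≤ maxQ Q s := (h s (Classical.arbitrary A)).trans (le_maxQ Q s _)

end MaxQ

/-- Iterated CVaR value iteration in which the entry at `(s₀, a₀)` is pinned to the value `u`. -/
noncomputable def pinnedVI {S A : Type*} [Fintype S] (τ γ : ℝ) (r : S → A → ℝ)
    (p : S → A → S → ℝ) (s₀ : S) (a₀ : A) (u : ℝ) : ℕ → S → A → ℝ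
  | 0 => fun _ _ => 0
  | n + 1 => fun s a => by
      classical
      exact if s = s₀ ∧ a = a₀ then u
        else cvarBellman τ γ r p (pinnedVI τ γ r p s₀ a₀ u n) s a

section Iteration

variable {S A : Type*} [Fintype S]

theorem pinnedVI_succ_self (τ γ : ℝ) (r : S → A → ℝ) (p : S → A → S → ℝ) (s₀ : S) (a₀ : A)
    (u : ℝ) (n : ℕ) : pinnedVI τ γ r p s₀ a₀ u (n + 1) s₀ a₀ = u := by
  simp [pinnedVI]

theorem pinnedVI_succ_of_ne (τ γ : ℝ) (r : S → A → ℝ) (p : S → A → S → ℝ) {s₀ : S} {a₀ : A}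
    (u : ℝ) (n : ℕ) {s : S} {a : A} (h : ¬(s = s₀ ∧ a = a₀)) :
    pinnedVI τ γ r p s₀ a₀ u (n + 1) s a =
      cvarBellman τ γ r p (pinnedVI τ γ r p s₀ a₀ u n) s a := by
  simp [pinnedVI, h]

/-- The kernel at `(s₀, a₀)` enters only the entry that is overwritten. For the empirical kernel
this makes the pinned iterates a function of the samples at the other pairs. -/
theorem pinnedVI_congr (τ γ : ℝ) (r : S → A → ℝ) {p p' : S → A → S → ℝ} {s₀ : S} {a₀ : A}
    (u : ℝ) (h : ∀ s a, ¬(s = s₀ ∧ a = a₀) → p s a = p' s a) (n : ℕ) :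
    pinnedVI τ γ r p s₀ a₀ u n = pinnedVI τ γ r p' s₀ a₀ u n := by
  induction n with
  | zero => rfl
  | succ n ih =>
    funext s a
    by_cases hsa : s = s₀ ∧ a = a₀
    · obtain ⟨rfl, rfl⟩ := hsa
      rw [pinnedVI_succ_self, pinnedVI_succ_self]
    · rw [pinnedVI_succ_of_ne _ _ _ _ _ _ hsa, pinnedVI_succ_of_ne _ _ _ _ _ _ hsa, ih]
      unfold cvarBellman
      rw [h s a hsa]

variable [Finite A] [Nonempty A] {τ γ : ℝ} {r : S → A → ℝ} {p : S → A → S → ℝ}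

theorem cvarBellman_le_add (h0 : 0 < τ) (h1 : τ ≤ 1) (hγ : 0 ≤ γ) (hp : ∀ s a s', 0 ≤ p s a s')
    (hs : ∀ s a, ∑ s', p s a s' = 1) {Q Q' : S → A → ℝ} {d : ℝ}
    (h : ∀ s a, Q s a ≤ Q' s a + d) (s : S) (a : A) :
    cvarBellman τ γ r p Q s a ≤ cvarBellman τ γ r p Q' s a + γ * d := by
  have := mul_le_mul_of_nonneg_left
    (cvar_le_add h0 h1 (hp s a) (hs s a) (maxQ_le_add h)) hγ
  unfold cvarBellman
  linarith

theorem abs_cvarBellman_sub_le (h0 : 0 < τ) (h1 : τ ≤ 1) (hγ : 0 ≤ γ)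
    (hp : ∀ s a s', 0 ≤ p s a s') (hs : ∀ s a, ∑ s', p s a s' = 1) {Q Q' : S → A → ℝ} {d : ℝ}
    (h : ∀ s a, |Q s a - Q' s a| ≤ d) (s : S) (a : A) :
    |cvarBellman τ γ r p Q s a - cvarBellman τ γ r p Q' s a| ≤ γ * d := by
  have b1 := cvarBellman_le_add (r := r) h0 h1 hγ hp hs (Q := Q) (Q' := Q') (d := d)
    (fun s a => by linarith [(abs_le.1 (h s a)).2]) s a
  have b2 := cvarBellman_le_add (r := r) h0 h1 hγ hp hs (Q := Q') (Q' := Q) (d := d)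
    (fun s a => by linarith [(abs_le.1 (h s a)).1]) s a
  rw [abs_le]
  constructor <;> linarith

theorem cvarBellman_mem (h0 : 0 < τ) (h1 : τ ≤ 1) (hγ : 0 ≤ γ) (hγ' : γ < 1)
    (hr0 : ∀ s a, 0 ≤ r s a) (hr1 : ∀ s a, r s a ≤ 1) (hp : ∀ s a s', 0 ≤ p s a s')
    (hs : ∀ s a, ∑ s', p s a s' = 1) {Q : S → A → ℝ}
    (h : ∀ s a, 0 ≤ Q s a ∧ Q s a ≤ 1 / (1 - γ)) (s : S) (a : A) :
    0 ≤ cvarBellman τ γ r p Q s a ∧ cvarBellman τ γ r p Q s a ≤ 1 / (1 - γ) := by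
  unfold cvarBellman
  have l := cvar_nonneg h0 h1 (hp s a) (hs s a) (maxQ_nonneg fun s a => (h s a).1)
  have g := cvar_le_of_le h0 h1 (hp s a) (hs s a)
    (fun s => maxQ_le fun a => (h s a).2)
  have e : 1 / (1 - γ) = 1 + γ * (1 / (1 - γ)) := by
    have : 0 < 1 - γ := by linarith
    field_simp; ring
  constructor
  · exact add_nonneg (hr0 s a) (mul_nonneg hγ l)
  · rw [e]
    exact add_le_add (hr1 s a) (mul_le_mul_of_nonneg_left g hγ)

theorem icvarVI_mem (h0 : 0 < τ) (h1 : τ ≤ 1) (hγ : 0 ≤ γ) (hγ' : γ < 1)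
    (hr0 : ∀ s a, 0 ≤ r s a) (hr1 : ∀ s a, r s a ≤ 1) (hp : ∀ s a s', 0 ≤ p s a s')
    (hs : ∀ s a, ∑ s', p s a s' = 1) (n : ℕ) :
    ∀ s a, 0 ≤ icvarVI τ γ r p n s a ∧ icvarVI τ γ r p n s a ≤ 1 / (1 - γ) := by
  induction n with
  | zero => exact fun _ _ => ⟨le_rfl, one_div_nonneg.2 (by linarith)⟩
  | succ n ih => exact cvarBellman_mem h0 h1 hγ hγ' hr0 hr1 hp hs ih

theorem icvarVI_le_succ (h0 : 0 < τ) (h1 : τ ≤ 1) (hγ : 0 ≤ γ) (hγ' : γ < 1)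
    (hr0 : ∀ s a, 0 ≤ r s a) (hr1 : ∀ s a, r s a ≤ 1) (hp : ∀ s a s', 0 ≤ p s a s')
    (hs : ∀ s a, ∑ s', p s a s' = 1) (n : ℕ) :
    ∀ s a, icvarVI τ γ r p n s a ≤ icvarVI τ γ r p (n + 1) s a := by
  induction n with
  | zero => exact fun s a => (icvarVI_mem h0 h1 hγ hγ' hr0 hr1 hp hs 1 s a).1
  | succ n ih =>
    intro s a
    have := cvarBellman_le_add (r := r) h0 h1 hγ hp hs (d := 0)
      (fun s a => by simpa using ih s a) s a
    simpa [icvarVI] using this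

/-- Both sides arise from `n` updates, started at the `m`-th iterate and at `0`; the initial gap is
at most `1 / (1 - γ)` and each update shrinks it by `γ`. -/
theorem icvarVI_add_le (h0 : 0 < τ) (h1 : τ ≤ 1) (hγ : 0 ≤ γ) (hγ' : γ < 1)
    (hr0 : ∀ s a, 0 ≤ r s a) (hr1 : ∀ s a, r s a ≤ 1) (hp : ∀ s a s', 0 ≤ p s a s')
    (hs : ∀ s a, ∑ s', p s a s' = 1) (m n : ℕ) :
    ∀ s a, icvarVI τ γ r p (m + n) s a ≤ icvarVI τ γ r p n s a + γ ^ n * (1 / (1 - γ)) := by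
  induction n with
  | zero => simpa [icvarVI] using fun s a => (icvarVI_mem h0 h1 hγ hγ' hr0 hr1 hp hs m s a).2
  | succ n ih =>
    intro s a
    have := cvarBellman_le_add (r := r) h0 h1 hγ hp hs ih s a
    rw [pow_succ', mul_assoc]
    exact this

theorem icvarVI_mono (h0 : 0 < τ) (h1 : τ ≤ 1) (hγ : 0 ≤ γ) (hγ' : γ < 1)
    (hr0 : ∀ s a, 0 ≤ r s a) (hr1 : ∀ s a, r s a ≤ 1) (hp : ∀ s a s', 0 ≤ p s a s')
    (hs : ∀ s a, ∑ s', p s a s' = 1) {m n : ℕ} (hmn : m ≤ n) (s : S) (a : A) :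
    icvarVI τ γ r p m s a ≤ icvarVI τ γ r p n s a :=
  monotone_nat_of_le_succ (f := fun n => icvarVI τ γ r p n s a)
    (fun n => icvarVI_le_succ h0 h1 hγ hγ' hr0 hr1 hp hs n s a) hmn

theorem pinnedVI_mem (h0 : 0 < τ) (h1 : τ ≤ 1) (hγ : 0 ≤ γ) (hγ' : γ < 1)
    (hr0 : ∀ s a, 0 ≤ r s a) (hr1 : ∀ s a, r s a ≤ 1) (hp : ∀ s a s', 0 ≤ p s a s')
    (hs : ∀ s a, ∑ s', p s a s' = 1) (s₀ : S) (a₀ : A) {u : ℝ} (hu0 : 0 ≤ u)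
    (hu1 : u ≤ 1 / (1 - γ)) (n : ℕ) :
    ∀ s a, 0 ≤ pinnedVI τ γ r p s₀ a₀ u n s a ∧
      pinnedVI τ γ r p s₀ a₀ u n s a ≤ 1 / (1 - γ) := by
  induction n with
  | zero => exact fun _ _ => ⟨le_rfl, one_div_nonneg.2 (by linarith)⟩
  | succ n ih =>
    intro s a
    by_cases hsa : s = s₀ ∧ a = a₀
    · obtain ⟨rfl, rfl⟩ := hsa
      rw [pinnedVI_succ_self]
      exact ⟨hu0, hu1⟩
    · rw [pinnedVI_succ_of_ne _ _ _ _ _ _ hsa]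
      exact cvarBellman_mem h0 h1 hγ hγ' hr0 hr1 hp hs ih s a

theorem abs_pinnedVI_succ_sub_le (h0 : 0 < τ) (h1 : τ ≤ 1) (hγ : 0 ≤ γ) (hγ' : γ < 1)
    (hr0 : ∀ s a, 0 ≤ r s a) (hr1 : ∀ s a, r s a ≤ 1) (hp : ∀ s a s', 0 ≤ p s a s')
    (hs : ∀ s a, ∑ s', p s a s' = 1) (s₀ : S) (a₀ : A) {u : ℝ} (hu0 : 0 ≤ u)
    (hu1 : u ≤ 1 / (1 - γ)) (n : ℕ) :
    ∀ s a, |pinnedVI τ γ r p s₀ a₀ u (n + 1) s a - pinnedVI τ γ r p s₀ a₀ u n s a| ≤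
      γ ^ n * (1 / (1 - γ)) := by
  have hH : 0 ≤ 1 / (1 - γ) := one_div_nonneg.2 (by linarith)
  induction n with
  | zero =>
    intro s a
    have := pinnedVI_mem h0 h1 hγ hγ' hr0 hr1 hp hs s₀ a₀ hu0 hu1 1 s a
    rw [abs_le]
    simp only [pinnedVI, pow_zero, one_mul, sub_zero] at this ⊢
    exact ⟨by linarith, this.2⟩
  | succ n ih =>
    intro s a
    by_cases hsa : s = s₀ ∧ a = a₀
    · obtain ⟨rfl, rfl⟩ := hsa
      rw [pinnedVI_succ_self, pinnedVI_succ_self, sub_self, abs_zero]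
      positivity
    · rw [pinnedVI_succ_of_ne _ _ _ _ _ _ hsa, pinnedVI_succ_of_ne _ _ _ _ _ _ hsa]
      have b1 := abs_cvarBellman_sub_le (r := r) h0 h1 hγ hp hs ih s a
      rw [pow_succ', mul_assoc]
      exact b1

/-- Pinning an entry to nearly the value that it has changes the iterates only little. -/
theorem abs_icvarVI_sub_pinnedVI_le (h0 : 0 < τ) (h1 : τ ≤ 1) (hγ : 0 ≤ γ) (hγ' : γ < 1)
    (hr0 : ∀ s a, 0 ≤ r s a) (hr1 : ∀ s a, r s a ≤ 1) (hp : ∀ s a s', 0 ≤ p s a s')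
    (hs : ∀ s a, ∑ s', p s a s' = 1) (s₀ : S) (a₀ : A) {u : ℝ} (hu0 : 0 ≤ u)
    (hu1 : u ≤ 1 / (1 - γ)) {n : ℕ} (hn : n ≠ 0) {η : ℝ}
    (hη : |icvarVI τ γ r p n s₀ a₀ - u| ≤ η) (s : S) (a : A) :
    |icvarVI τ γ r p n s a - pinnedVI τ γ r p s₀ a₀ u n s a| ≤
      η + 2 * (1 / (1 - γ)) ^ 2 * γ ^ n := by
  have hη0 : 0 ≤ η := (abs_nonneg _).trans hη
  have h1γ : 0 < 1 - γ := by linarith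
  have hH : 0 ≤ 1 / (1 - γ) := one_div_nonneg.2 h1γ.le
  set R := icvarVI τ γ r p n with hR
  set W := pinnedVI τ γ r p s₀ a₀ u n with hW
  have hne : Nonempty (S × A) := ⟨(s, a)⟩
  -- At the worst entry, either the pin itself bounds the gap `D`, or both iterates satisfy the same
  -- Bellman equation up to `γ ^ n / (1 - γ)`, so that `D ≤ γ D + 2 γ ^ n / (1 - γ)`.
  obtain ⟨⟨t, b⟩, hmax⟩ := Finite.exists_max fun k : S × A => |R k.1 k.2 - W k.1 k.2|
  refine (hmax (s, a)).trans ?_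
  set D := |R t b - W t b| with hD
  change D ≤ _
  have hmax' : ∀ s a, |R s a - W s a| ≤ D := fun s a => hmax (s, a)
  by_cases htb : t = s₀ ∧ b = a₀
  · obtain ⟨m, rfl⟩ := Nat.exists_eq_succ_of_ne_zero hn
    have : D ≤ η := by
      rw [hD, htb.1, htb.2, hW, Nat.succ_eq_add_one, pinnedVI_succ_self]
      exact hη
    have : 0 ≤ 2 * (1 / (1 - γ)) ^ 2 * γ ^ m.succ := by positivity
    linarith
  · have d1 : |icvarVI τ γ r p (n + 1) t b - R t b| ≤ γ ^ n * (1 / (1 - γ)) := by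
      have := icvarVI_add_le h0 h1 hγ hγ' hr0 hr1 hp hs 1 n t b
      rw [add_comm 1 n] at this
      rw [abs_of_nonneg (sub_nonneg.2 (icvarVI_le_succ h0 h1 hγ hγ' hr0 hr1 hp hs n t b))]
      linarith
    have d2 := abs_pinnedVI_succ_sub_le h0 h1 hγ hγ' hr0 hr1 hp hs s₀ a₀ hu0 hu1 n t b
    rw [pinnedVI_succ_of_ne _ _ _ _ _ _ htb, ← hW] at d2
    change |cvarBellman τ γ r p R t b - R t b| ≤ _ at d1
    have b1 := abs_cvarBellman_sub_le (r := r) h0 h1 hγ hp hs hmax' t b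
    rw [abs_le] at d1 d2 b1
    have hDle : D ≤ γ * D + 2 * (γ ^ n * (1 / (1 - γ))) := by
      rw [hD, abs_le]
      constructor <;> linarith
    have e : D ≤ 2 * (γ ^ n * (1 / (1 - γ))) / (1 - γ) := by
      rw [le_div_iff₀ h1γ]; linarith
    have e2 : 2 * (γ ^ n * (1 / (1 - γ))) / (1 - γ) = 2 * (1 / (1 - γ)) ^ 2 * γ ^ n := by
      field_simp
    linarith

end Iteration

/-! ### Exponential moments and Bernstein bounds for the empirical kernel -/

/-- Use `exp x ≤ 1 + x + x²` for `|x| ≤ 1`: the linear term has mean zero and the quadratic one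
gives the variance. -/
theorem sum_weights_exp_le_exp {S : Type*} [Fintype S] {p Z : S → ℝ} (hp : ∀ s, 0 ≤ p s)
    (hs : ∑ s, p s = 1) {l : ℝ} (h : ∀ s, |l * (Z s - ∑ t, p t * Z t)| ≤ 1) :
    ∑ s, p s * Real.exp (l * (Z s - ∑ t, p t * Z t)) ≤ Real.exp (l ^ 2 * weightedVar p Z) := by
  set m := ∑ t, p t * Z t with hm
  have key : ∀ s, p s * Real.exp (l * (Z s - m)) ≤
      p s + l * (p s * Z s - m * p s) + l ^ 2 * (p s * (Z s - m) ^ 2) := by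
    intro s
    have := (abs_le.1 (Real.abs_exp_sub_one_sub_id_le (h s))).2
    nlinarith [mul_le_mul_of_nonneg_left this (hp s)]
  calc _ ≤ _ := Finset.sum_le_sum fun s _ => key s
    _ = 1 + l ^ 2 * weightedVar p Z := by
      rw [Finset.sum_add_distrib, Finset.sum_add_distrib, ← Finset.mul_sum, ← Finset.mul_sum,
        Finset.sum_sub_distrib, ← Finset.mul_sum, hs, ← hm]
      unfold weightedVar
      ring
    _ ≤ _ := by linarith [Real.add_one_le_exp (l ^ 2 * weightedVar p Z)]

section Empirical

variable {S A : Type*} [DecidableEq S] {N : ℕ}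

theorem empiricalKernel_nonneg (ω : S × A × Fin N → S) (s : S) (a : A) (s' : S) :
    0 ≤ empiricalKernel ω s a s' := by
  unfold empiricalKernel
  refine mul_nonneg (by positivity) (Finset.sum_nonneg fun i _ => ?_)
  split_ifs <;> norm_num

theorem sum_empiricalKernel_mul [Fintype S] (ω : S × A × Fin N → S) (s : S) (a : A) (f : S → ℝ) :
    ∑ s', empiricalKernel ω s a s' * f s' = 1 / N * ∑ i : Fin N, f (ω (s, a, i)) := by
  unfold empiricalKernel
  simp_rw [mul_assoc]
  rw [← Finset.mul_sum]
  congr 1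
  simp_rw [Finset.sum_mul]
  rw [Finset.sum_comm]
  simp

theorem sum_empiricalKernel [Fintype S] (hN : N ≠ 0) (ω : S × A × Fin N → S) (s : S) (a : A) :
    ∑ s', empiricalKernel ω s a s' = 1 := by
  have := sum_empiricalKernel_mul ω s a fun _ => 1
  simp only [mul_one, Finset.sum_const, Finset.card_univ, Fintype.card_fin, nsmul_eq_mul] at this
  rw [this]
  field_simp

end Empirical

namespace MDP

variable {S A : Type*}

theorem prob_nonneg (M : MDP S A) (s : S) (a : A) (s' : S) : 0 ≤ M.prob s a s' :=
  ENNReal.toReal_nonneg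

variable [Fintype S]

theorem sum_prob (M : MDP S A) (s : S) (a : A) : ∑ s', M.prob s a s' = 1 :=
  pmf_sum_toReal (M.P s a)

variable [Fintype A] [MeasurableSpace S] [MeasurableSingletonClass S]

instance (M : MDP S A) (N : ℕ) : IsProbabilityMeasure (M.sampleLaw N) := by
  unfold sampleLaw; infer_instance

/-- The exponential moment of the samples at one state-action pair, for a test function that is
determined by the other samples. -/
theorem integral_exp_deviation_le (M : MDP S A) {N : ℕ} (s₀ : S) (a₀ : A)
    (g : (S × A × Fin N → S) → S → ℝ)
    (hg : ∀ ω ω', (∀ k, ¬(k.1 = s₀ ∧ k.2.1 = a₀) → ω k = ω' k) → g ω = g ω') {l : ℝ}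
    (hl : ∀ ω s, |l * (g ω s - ∑ t, M.prob s₀ a₀ t * g ω t)| ≤ 1) :
    ∫ ω, ∏ i : Fin N, (Real.exp (l * (g ω (ω (s₀, a₀, i)) - ∑ t, M.prob s₀ a₀ t * g ω t)) *
      Real.exp (-(l ^ 2 * weightedVar (M.prob s₀ a₀) (g ω)))) ∂(M.sampleLaw N) ≤ 1 := by
  classical
  let pr : S × A × Fin N → Prop := fun k => k.1 = s₀ ∧ k.2.1 = a₀
  let h : (S → ℝ) → S → ℝ := fun f s => Real.exp (l * (f s - ∑ t, M.prob s₀ a₀ t * f t)) *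
      Real.exp (-(l ^ 2 * weightedVar (M.prob s₀ a₀) f))
  let i₀ : Fin N ≃ {k // pr k} :=
    { toFun := fun i => ⟨(s₀, a₀, i), rfl, rfl⟩
      invFun := fun k => k.1.2.2
      left_inv := fun i => rfl
      right_inv := by
        rintro ⟨⟨s, a, i⟩, h1, h2⟩
        simp only at h1 h2
        subst h1 h2
        rfl }
  -- Condition on the samples at the other pairs. The test function is then a fixed `f`, and the
  -- integrand is a product over independent samples. The compensator `exp (-l² Var)` stays inside
  -- the integral because the variance is itself random.
  let e := MeasurableEquiv.piEquivPiSubtypeProd (fun _ : S × A × Fin N => S) pr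
  have hmp := measurePreserving_piEquivPiSubtypeProd
    (fun k : S × A × Fin N => (M.P k.1 k.2.1).toMeasure) pr
  have hint := hmp.symm.integral_comp' (g := fun ω => ∏ i : Fin N, h (g ω) (ω (s₀, a₀, i)))
  change ∫ ω, ∏ i : Fin N, h (g ω) (ω (s₀, a₀, i)) ∂(Measure.pi _) ≤ 1
  rw [← hint, integral_prod_symm _ .of_finite]
  have hinner : ∀ y : ({k // ¬ pr k} → S),
      ∫ x : ({k // pr k} → S), ∏ i : Fin N, h (g (e.symm (x, y))) (e.symm (x, y) (s₀, a₀, i))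
        ∂(Measure.pi fun k : {k // pr k} => (M.P k.1.1 k.1.2.1).toMeasure) ≤ 1 := by
    intro y
    -- An arbitrary filler: `g` does not see these coordinates.
    let x₀ : {k // pr k} → S := fun _ => s₀
    set f := g (e.symm (x₀, y)) with hf
    have hgf : ∀ x, g (e.symm (x, y)) = f := by
      intro x
      refine hg _ _ fun k hk => ?_
      have hk' : ¬ pr k := hk
      change (if h : pr k then x ⟨k, h⟩ else y ⟨k, h⟩) =
        (if h : pr k then x₀ ⟨k, h⟩ else y ⟨k, h⟩)
      rw [dif_neg hk', dif_neg hk']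
    have hcoord : ∀ x i, e.symm (x, y) (s₀, a₀, i) = x (i₀ i) := by
      intro x i
      have hk : pr (s₀, a₀, i) := ⟨rfl, rfl⟩
      change (if h : pr (s₀, a₀, i) then x ⟨_, h⟩ else y ⟨_, h⟩) = _
      rw [dif_pos hk]
      rfl
    have hprod : ∀ x : ({k // pr k} → S),
        ∏ i : Fin N, h (g (e.symm (x, y))) (e.symm (x, y) (s₀, a₀, i)) =
          ∏ k : {k // pr k}, h f (x k) := by
      intro x
      rw [← i₀.prod_comp]
      exact Finset.prod_congr rfl fun i _ => by rw [hgf, hcoord]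
    simp_rw [hprod]
    rw [integral_fintype_prod_eq_prod (fun _ : {k // pr k} => h f)]
    refine Finset.prod_le_one (fun k _ => integral_nonneg fun s => by positivity) ?_
    rintro ⟨⟨s, a, i⟩, h1, h2⟩ -
    simp only at h1 h2
    subst h1 h2
    rw [PMF.integral_eq_sum]
    have := sum_weights_exp_le_exp (M.prob_nonneg s a) (M.sum_prob s a)
      (hl (e.symm (x₀, y)))
    calc ∑ t, (M.P s a t).toReal • h f t =
          (∑ t, M.prob s a t * Real.exp (l * (f t - ∑ t, M.prob s a t * f t))) *
            Real.exp (-(l ^ 2 * weightedVar (M.prob s a) f)) := by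
          rw [Finset.sum_mul]
          refine Finset.sum_congr rfl fun t _ => ?_
          simp only [h, smul_eq_mul, MDP.prob]
          ring
      _ ≤ Real.exp (l ^ 2 * weightedVar (M.prob s a) f) *
            Real.exp (-(l ^ 2 * weightedVar (M.prob s a) f)) := by gcongr
      _ = 1 := by rw [← Real.exp_add]; simp
  refine (integral_mono .of_finite (integrable_const (1 : ℝ)) hinner).trans ?_
  simp

/-- A Bernstein-type bound for the empirical mean at one state-action pair of a test function that
is determined by the other samples. -/
theorem sampleLaw_deviation_le [DecidableEq S] (M : MDP S A) {N : ℕ} (hN : N ≠ 0) (s₀ : S)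
    (a₀ : A) (g : (S × A × Fin N → S) → S → ℝ)
    (hg : ∀ ω ω', (∀ k, ¬(k.1 = s₀ ∧ k.2.1 = a₀) → ω k = ω' k) → g ω = g ω') {l : ℝ} (hl0 : 0 < l)
    (hl : ∀ ω s, |l * (g ω s - ∑ t, M.prob s₀ a₀ t * g ω t)| ≤ 1) (L : ℝ) :
    (M.sampleLaw N).real {ω | l * weightedVar (M.prob s₀ a₀) (g ω) + L / (l * N) ≤
      ∑ t, empiricalKernel ω s₀ a₀ t * g ω t - ∑ t, M.prob s₀ a₀ t * g ω t} ≤ Real.exp (-L) := by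
  have hN' : (0 : ℝ) < N := by positivity
  have h1 := M.integral_exp_deviation_le s₀ a₀ g hg hl
  set F : (S × A × Fin N → S) → ℝ := fun ω => ∏ i : Fin N,
    (Real.exp (l * (g ω (ω (s₀, a₀, i)) - ∑ t, M.prob s₀ a₀ t * g ω t)) *
      Real.exp (-(l ^ 2 * weightedVar (M.prob s₀ a₀) (g ω)))) with hF
  -- Markov's inequality at level `exp L`, applied to the compensated exponential of mean at most
  -- one.
  have h2 := mul_meas_ge_le_integral_of_nonneg (μ := M.sampleLaw N) (f := F)
    (.of_forall fun ω => by simp only [hF, Pi.zero_apply]; positivity) .of_finite (Real.exp L)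
  have hsub : {ω | l * weightedVar (M.prob s₀ a₀) (g ω) + L / (l * N) ≤
      ∑ t, empiricalKernel ω s₀ a₀ t * g ω t - ∑ t, M.prob s₀ a₀ t * g ω t} ⊆
      {ω | Real.exp L ≤ F ω} := by
    intro ω hω
    simp only [Set.mem_ofPred_eq, sum_empiricalKernel_mul] at hω ⊢
    simp only [hF, ← Real.exp_add, ← Real.exp_sum]
    rw [Real.exp_le_exp, Finset.sum_add_distrib, ← Finset.mul_sum, Finset.sum_sub_distrib]
    simp only [Finset.sum_const, Finset.card_univ, Fintype.card_fin, nsmul_eq_mul]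
    have := mul_le_mul_of_nonneg_left hω (mul_pos hl0 hN').le
    have e1 : l * N * (l * weightedVar (M.prob s₀ a₀) (g ω) + L / (l * N)) =
        N * (l ^ 2 * weightedVar (M.prob s₀ a₀) (g ω)) + L := by field_simp
    have e2 : l * N * (1 / N * ∑ i : Fin N, g ω (ω (s₀, a₀, i)) - ∑ t, M.prob s₀ a₀ t * g ω t) =
        l * (∑ i : Fin N, g ω (ω (s₀, a₀, i)) - N * ∑ t, M.prob s₀ a₀ t * g ω t) := by
      field_simp
    linarith
  have h3 : (M.sampleLaw N).real {ω | Real.exp L ≤ F ω} ≤ Real.exp (-L) := by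
    rw [Real.exp_neg, ← one_div, le_div_iff₀ (Real.exp_pos L)]
    linarith
  exact (measureReal_mono hsub).trans h3

end MDP

/-! ### Propagation of CVaR errors, with telescoping variances -/

/-- The variance of the next value is controlled by the increments of the squared value and the
defect `v - γ E[V]` in the Bellman equation. -/
theorem mul_weightedVar_le {S : Type*} [Fintype S] {q V : S → ℝ} (hq : ∀ s, 0 ≤ q s)
    (hqs : ∑ s, q s = 1) {γ H v c : ℝ} (hγ : 0 ≤ γ) (hγ' : γ ≤ 1) (hV : ∀ s, 0 ≤ V s)
    (hv0 : 0 ≤ v) (hv1 : v ≤ H) (hc0 : 0 ≤ c) (hc : v - γ * ∑ s, q s * V s ≤ c) :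
    γ * weightedVar q V ≤ γ * ∑ s, q s * V s ^ 2 - v ^ 2 + 2 * H * c := by
  rw [weightedVar_eq q V hqs]
  set m := ∑ s, q s * V s
  have hm : 0 ≤ m := le_weighted hq hqs hV
  have h1 : (γ * m) ^ 2 ≤ γ * m ^ 2 := by
    nlinarith [mul_nonneg (mul_nonneg hγ (sub_nonneg.2 hγ')) (sq_nonneg m)]
  have hγm : 0 ≤ γ * m := mul_nonneg hγ hm
  -- Factor `v² - (γ m)²`; only the case `γ m ≤ v` matters, and there the sum of the factors' terms
  -- `v + γ m` is at most `2 H`.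
  have h2 : v ^ 2 ≤ (γ * m) ^ 2 + 2 * H * c := by
    rcases le_total v (γ * m) with h | h
    · have := mul_nonneg (hv0.trans hv1) hc0
      nlinarith
    · have h3 : (v - γ * m) * (v + γ * m) ≤ c * (2 * H) :=
        mul_le_mul hc (by linarith) (by linarith) hc0
      nlinarith
  linarith

namespace MDP

variable {S A : Type*}

theorem one_add_mul_horizon (M : MDP S A) : 1 / (1 - M.γ) = 1 + M.γ * (1 / (1 - M.γ)) := by
  have : 0 < 1 - M.γ := by linarith [M.γ_lt_one]
  field_simp; ring

theorem one_le_horizon (M : MDP S A) : 1 ≤ 1 / (1 - M.γ) := by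
  rw [le_div_iff₀ (by linarith [M.γ_lt_one])]
  linarith [M.γ_nonneg]

variable [Fintype S] [Fintype A]

theorem nestedValue_succ_pure (M : MDP S A) (τ : ℝ) (π : S → A) (n : ℕ) (s : S) :
    M.nestedValue τ (fun s => PMF.pure (π s)) (n + 1) s = M.r s (π s) +
      M.γ * cvar τ (M.prob s (π s)) (M.nestedValue τ (fun s => PMF.pure (π s)) n) := by
  classical
  have h : ∀ f : A → ℝ, ∑ a, (PMF.pure (π s) a).toReal * f a = f (π s) := by
    intro f
    rw [Finset.sum_eq_single (π s)]
    · simp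
    · intro b _ hb
      simp [PMF.pure_apply, hb]
    · simp
  change _ + _ * _ = _
  rw [h, h]

/-- A policy that is nearly greedy for an approximate value function `V` has almost value `V`. -/
theorem sub_value_pure_le (M : MDP S A) {τ : ℝ} (h0 : 0 < τ) (h1 : τ ≤ 1) {V : S → ℝ}
    (hV0 : ∀ s, 0 ≤ V s) (hV1 : ∀ s, V s ≤ 1 / (1 - M.γ)) {p : S → A → S → ℝ} {κ b ζ : ℝ}
    (hκ : 0 ≤ κ) (hκ' : 4 * κ * (1 / (1 - M.γ)) ≤ 1) (hζ0 : 0 ≤ ζ) (hζ : ζ ≤ 1)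
    (herr : ∀ s a, ∀ q : S → ℝ, (∀ s', 0 ≤ q s') → (∀ s', τ * q s' ≤ M.prob s a s') →
      ∑ s', q s' = 1 → M.γ * |cvar τ (p s a) V - cvar τ (M.prob s a) V| ≤
        κ * (M.γ * weightedVar q V) + b)
    {π : S → A} (hπ : ∀ s, V s ≤ M.r s (π s) + M.γ * cvar τ (p s (π s)) V + ζ) (s : S) :
    V s - M.value τ (fun s => PMF.pure (π s)) s ≤
      1 / (1 - M.γ) * (ζ + 8 * κ * (1 / (1 - M.γ)) + 2 * b) := by
  have hH := M.one_add_mul_horizon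
  have hH1 := M.one_le_horizon
  have hγ := M.γ_nonneg
  set γ := M.γ with hγdef
  set H := 1 / (1 - γ) with hHdef
  set W := fun n => M.nestedValue τ (fun s => PMF.pure (π s)) n with hW
  set D := H + 2 * κ * H ^ 2 with hD
  set B := ζ + 8 * κ * H + 2 * b with hB
  -- The potential `2 κ V²` absorbs the variances. Its factor 2 comes from the CVaR error `β` also
  -- entering the defect `c`: since `2 κ H ≤ 1 / 2`, half of `β` is moved to the left side.
  have key : ∀ n s, V s - W n s + 2 * κ * V s ^ 2 ≤ H * B + γ ^ n * (D - H * B) := by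
    intro n
    induction n with
    | zero =>
      intro s
      have hsq : V s ^ 2 ≤ H ^ 2 := pow_le_pow_left₀ (hV0 s) (hV1 s) 2
      have : W 0 s = 0 := rfl
      rw [this, pow_zero]
      have := mul_le_mul_of_nonneg_left hsq hκ
      linarith [hV1 s]
    | succ n ih =>
      intro s
      -- The weights are optimal for the policy's own value, so its recursion is exact while `V`
      -- satisfies an inequality in the right direction. They are not known in advance, hence `herr`
      -- is required for all admissible `q`.
      obtain ⟨-, q, hq0, hqp, hqs, -, hq⟩ :=
        exists_cvar_eq h0 h1 (M.prob_nonneg s (π s)) (M.sum_prob s (π s)) (W n)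
      have hqV := cvar_le_of_dominated h0 hq0 hqp hqs V
      have he := herr s (π s) q hq0 hqp hqs
      set β := γ * |cvar τ (p s (π s)) V - cvar τ (M.prob s (π s)) V| with hβ
      have hβ0 : 0 ≤ β := mul_nonneg hγ (abs_nonneg _)
      have hβ1 : γ * cvar τ (p s (π s)) V ≤ γ * cvar τ (M.prob s (π s)) V + β := by
        rw [hβ, ← mul_add]
        exact mul_le_mul_of_nonneg_left
          (by linarith [le_abs_self (cvar τ (p s (π s)) V - cvar τ (M.prob s (π s)) V)]) hγ
      have hγqV := mul_le_mul_of_nonneg_left hqV hγ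
      have hvar := mul_weightedVar_le (c := 1 + ζ + β) hq0 hqs hγ M.γ_lt_one.le hV0 (hV0 s)
        (hV1 s) (by linarith) (by linarith [hπ s, M.r_le_one s (π s)])
      have hvar' := mul_le_mul_of_nonneg_left hvar hκ
      have hih : ∑ t, q t * (V t - W n t + 2 * κ * V t ^ 2) ≤ H * B + γ ^ n * (D - H * B) :=
        weighted_le hq0 hqs ih
      have hexp : ∑ t, q t * (V t - W n t + 2 * κ * V t ^ 2) =
          ∑ t, q t * V t - ∑ t, q t * W n t + 2 * κ * ∑ t, q t * V t ^ 2 := by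
        rw [Finset.mul_sum, ← Finset.sum_sub_distrib, ← Finset.sum_add_distrib]
        exact Finset.sum_congr rfl fun t _ => by ring
      rw [hexp] at hih
      have hih' := mul_le_mul_of_nonneg_left hih hγ
      have hWs : W (n + 1) s = M.r s (π s) + γ * ∑ t, q t * W n t := by
        rw [hW]
        dsimp only
        rw [nestedValue_succ_pure, ← hq]
      have hκβ := mul_le_mul_of_nonneg_right hκ' hβ0
      have hκζ := mul_le_mul_of_nonneg_left hζ (mul_nonneg hκ (by linarith : (0 : ℝ) ≤ H))
      have hHB : H * B = B + γ * (H * B) := by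
        nth_rewrite 1 [hH]; ring
      have hπs := hπ s
      have hpow : γ ^ (n + 1) = γ * γ ^ n := pow_succ' γ n
      rw [hWs, hpow]
      linarith
  have hlim : Tendsto (fun n => V s - W n s) atTop
      (nhds (V s - M.value τ (fun s => PMF.pure (π s)) s)) :=
    tendsto_const_nhds.sub (M.tendsto_nestedValue h0 h1 _ s)
  have hlim' : Tendsto (fun n : ℕ => H * B + γ ^ n * (D - H * B)) atTop
      (nhds (H * B + 0 * (D - H * B))) :=
    tendsto_const_nhds.add
      ((tendsto_pow_atTop_nhds_zero_of_lt_one hγ M.γ_lt_one).mul tendsto_const_nhds)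
  have := le_of_tendsto_of_tendsto' hlim hlim' fun n => by
    have h2 : 0 ≤ 2 * κ * V s ^ 2 := by positivity
    linarith [key n s]
  linarith

/-- No policy has a value much larger than an approximate value function `V`. -/
theorem value_sub_le (M : MDP S A) {τ : ℝ} (h0 : 0 < τ) (h1 : τ ≤ 1) {V : S → ℝ}
    (hV0 : ∀ s, 0 ≤ V s) (hV1 : ∀ s, V s ≤ 1 / (1 - M.γ)) {p : S → A → S → ℝ} {κ b ζ : ℝ}
    (hκ : 0 ≤ κ) (hκ' : 4 * κ * (1 / (1 - M.γ)) ≤ 1) (hb : 0 ≤ b) (hζ0 : 0 ≤ ζ)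
    (herr : ∀ s a, ∀ q : S → ℝ, (∀ s', 0 ≤ q s') → (∀ s', τ * q s' ≤ M.prob s a s') →
      ∑ s', q s' = 1 → M.γ * |cvar τ (p s a) V - cvar τ (M.prob s a) V| ≤
        κ * (M.γ * weightedVar q V) + b)
    (hopt : ∀ s a, M.r s a + M.γ * cvar τ (p s a) V ≤ V s + ζ) (π : S → PMF A) (s : S) :
    M.value τ π s - V s ≤
      1 / (1 - M.γ) * (2 * ζ + 2 * b) + 2 * κ * (1 / (1 - M.γ)) ^ 2 := by
  have hH := M.one_add_mul_horizon
  have hH1 := M.one_le_horizon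
  have hγ := M.γ_nonneg
  set γ := M.γ with hγdef
  set H := 1 / (1 - γ) with hHdef
  set W := M.nestedValue τ π with hW
  set B := 2 * ζ + 2 * b with hB
  have hHB : H * B = B + γ * (H * B) := by
    nth_rewrite 1 [hH]; ring
  have hHB0 : 0 ≤ H * B := by positivity
  -- An arbitrary policy may have a large Bellman defect `V s - γ E_q[V]`. The additional linear
  -- potential `-4 κ H V` makes this defect telescope too; at the end, completing the square costs
  -- `2 κ H²`.
  have key : ∀ n s, W n s - V s + 2 * κ * V s ^ 2 - 4 * κ * H * V s ≤ H * B := by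
    intro n
    induction n with
    | zero =>
      intro s
      have : W 0 s = 0 := rfl
      rw [this]
      have h2 : 0 ≤ κ * (V s * (2 * H - V s)) :=
        mul_nonneg hκ (mul_nonneg (hV0 s) (by linarith [hV1 s]))
      nlinarith [hV0 s]
    | succ n ih =>
      intro s
      have step : ∀ a, M.r s a + γ * cvar τ (M.prob s a) (W n) ≤
          V s - 2 * κ * V s ^ 2 + 4 * κ * H * V s + H * B := by
        intro a
        -- Here the weights are optimal for `V`, since an upper bound on the policy's value is
        -- wanted.
        obtain ⟨-, q, hq0, hqp, hqs, -, hq⟩ :=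
          exists_cvar_eq h0 h1 (M.prob_nonneg s a) (M.sum_prob s a) V
        have hqW := mul_le_mul_of_nonneg_left (cvar_le_of_dominated h0 hq0 hqp hqs (W n)) hγ
        have he := herr s a q hq0 hqp hqs
        set β := γ * |cvar τ (p s a) V - cvar τ (M.prob s a) V| with hβ
        have hβ0 : 0 ≤ β := mul_nonneg hγ (abs_nonneg _)
        have hβ1 : γ * cvar τ (M.prob s a) V ≤ γ * cvar τ (p s a) V + β := by
          rw [hβ, ← mul_add]
          exact mul_le_mul_of_nonneg_left
            (by linarith [neg_abs_le (cvar τ (p s a) V - cvar τ (M.prob s a) V)]) hγ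
        rw [hq] at hβ1
        have hs := hopt s a
        have hvar := mul_weightedVar_le (c := V s - γ * ∑ t, q t * V t + β + ζ) hq0 hqs hγ
          M.γ_lt_one.le hV0 (hV0 s) (hV1 s) (by linarith [M.r_nonneg s a]) (by linarith)
        have hvar' := mul_le_mul_of_nonneg_left hvar hκ
        have hih : ∑ t, q t * (W n t - V t + 2 * κ * V t ^ 2 - 4 * κ * H * V t) ≤ H * B :=
          weighted_le hq0 hqs ih
        have hexp : ∑ t, q t * (W n t - V t + 2 * κ * V t ^ 2 - 4 * κ * H * V t) =
            ∑ t, q t * W n t - ∑ t, q t * V t + 2 * κ * ∑ t, q t * V t ^ 2 -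
              4 * κ * H * ∑ t, q t * V t := by
          rw [Finset.mul_sum, Finset.mul_sum, ← Finset.sum_sub_distrib, ← Finset.sum_add_distrib,
            ← Finset.sum_sub_distrib]
          exact Finset.sum_congr rfl fun t _ => by ring
        rw [hexp] at hih
        have hih' := mul_le_mul_of_nonneg_left hih hγ
        have hκβ := mul_le_mul_of_nonneg_right hκ' hβ0
        have hκζ := mul_le_mul_of_nonneg_right hκ' hζ0
        rw [hHB]
        nlinarith
      have hWs : W (n + 1) s =
          ∑ a, (π s a).toReal * (M.r s a + γ * cvar τ (M.prob s a) (W n)) := by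
        change _ + _ * _ = _
        rw [Finset.mul_sum, ← Finset.sum_add_distrib]
        exact Finset.sum_congr rfl fun a _ => by ring
      have := weighted_le (fun a => ENNReal.toReal_nonneg) (pmf_sum_toReal (π s)) step
      linarith
  have hlim : Tendsto (fun n => W n s - V s) atTop (nhds (M.value τ π s - V s)) :=
    (M.tendsto_nestedValue h0 h1 _ s).sub tendsto_const_nhds
  refine le_of_tendsto' hlim fun n => ?_
  have h2 : 0 ≤ κ * (H - V s) ^ 2 := by positivity
  nlinarith [key n s]

/-- Greedy policies of approximate value iteration are nearly optimal if the kernel `p` in use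
approximates the CVaR of the computed value function. -/
theorem isEpsOptimal_of_cvar_error (M : MDP S A) [Nonempty A] {τ : ℝ} (h0 : 0 < τ) (h1 : τ ≤ 1)
    {p : S → A → S → ℝ} (hp : ∀ s a s', 0 ≤ p s a s') (hs : ∀ s a, ∑ s', p s a s' = 1)
    {T T' : ℕ} (hT : T ≤ T') {κ b ε : ℝ} (hκ : 0 ≤ κ) (hκ' : 4 * κ * (1 / (1 - M.γ)) ≤ 1)
    (hb : 0 ≤ b) (hζ : M.γ ^ T * (1 / (1 - M.γ)) ≤ 1)
    (herr : ∀ s a, ∀ q : S → ℝ, (∀ s', 0 ≤ q s') → (∀ s', τ * q s' ≤ M.prob s a s') →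
      ∑ s', q s' = 1 →
      M.γ * |cvar τ (p s a) (maxQ (icvarVI τ M.γ M.r p T')) -
          cvar τ (M.prob s a) (maxQ (icvarVI τ M.γ M.r p T'))| ≤
        κ * (M.γ * weightedVar q (maxQ (icvarVI τ M.γ M.r p T'))) + b)
    (hε : 3 * M.γ ^ T * (1 / (1 - M.γ)) ^ 2 + 10 * κ * (1 / (1 - M.γ)) ^ 2 +
      4 * b * (1 / (1 - M.γ)) ≤ ε)
    {π : S → A} (hπ : IsGreedy (icvarVI τ M.γ M.r p T) π) :
    M.IsEpsOptimal τ ε fun s => PMF.pure (π s) := by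
  have hγ := M.γ_nonneg
  have hγ' := M.γ_lt_one
  have hH1 := M.one_le_horizon
  have hmem := icvarVI_mem h0 h1 hγ hγ' M.r_nonneg M.r_le_one hp hs T'
  have hζ0 : 0 ≤ M.γ ^ T * (1 / (1 - M.γ)) := by positivity
  have hV0 := maxQ_nonneg fun s a => (hmem s a).1
  have hV1 : ∀ s, maxQ (icvarVI τ M.γ M.r p T') s ≤ 1 / (1 - M.γ) :=
    fun s => maxQ_le fun a => (hmem s a).2
  have hsucc : ∀ s a, icvarVI τ M.γ M.r p (T' + 1) s a = M.r s a +
      M.γ * cvar τ (p s a) (maxQ (icvarVI τ M.γ M.r p T')) := fun _ _ => rfl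
  have hA := M.sub_value_pure_le h0 h1 hV0 hV1 hκ hκ' hζ0 hζ herr (π := π) (by
    intro s
    have e1 := maxQ_le_add (icvarVI_add_le h0 h1 hγ hγ' M.r_nonneg M.r_le_one hp hs (T' - T) T) s
    rw [Nat.sub_add_cancel hT] at e1
    have e2 : maxQ (icvarVI τ M.γ M.r p T) s ≤ icvarVI τ M.γ M.r p T s (π s) := maxQ_le (hπ s)
    have e3 := icvarVI_mono h0 h1 hγ hγ' M.r_nonneg M.r_le_one hp hs (hT.trans T'.le_succ) s (π s)
    rw [Nat.succ_eq_add_one, hsucc] at e3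
    linarith)
  have hB := M.value_sub_le h0 h1 hV0 hV1 hκ hκ' hb hζ0 herr (by
    intro s a
    have e1 := icvarVI_add_le h0 h1 hγ hγ' M.r_nonneg M.r_le_one hp hs 1 T' s a
    rw [add_comm 1 T', hsucc] at e1
    have e2 := le_maxQ (icvarVI τ M.γ M.r p T') s a
    have e3 : M.γ ^ T' * (1 / (1 - M.γ)) ≤ M.γ ^ T * (1 / (1 - M.γ)) :=
      mul_le_mul_of_nonneg_right (pow_le_pow_of_le_one hγ hγ'.le hT) (by linarith)
    linarith)
  intro s
  have : M.optValue τ s ≤ maxQ (icvarVI τ M.γ M.r p T') s +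
      (1 / (1 - M.γ) * (2 * (M.γ ^ T * (1 / (1 - M.γ))) + 2 * b) +
        2 * κ * (1 / (1 - M.γ)) ^ 2) := by
    have : Nonempty (S → PMF A) := ⟨fun _ => PMF.pure (Classical.arbitrary A)⟩
    exact ciSup_le fun π' => by linarith [hB π' s]
  nlinarith [hA s]

/-! ### Uniform concentration of the CVaR of the computed value -/

variable [MeasurableSpace S] [MeasurableSingletonClass S]

/-- With high probability the CVaR of the value function computed from the samples is nearly the
same under the empirical kernel and under the true one. -/
theorem sampleLaw_cvar_error [DecidableEq S] [Nonempty A] (M : MDP S A) {τ : ℝ} (h0 : 0 < τ)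
    (h1 : τ ≤ 1) {N n : ℕ} (hN : N ≠ 0) (hn : n ≠ 0) {l η L δ : ℝ} (hl0 : 0 < l)
    (hl1 : l * (1 / (1 - M.γ)) ≤ 1) (hη : 0 < η) (hlη : l * η ≤ 1)
    (hnη : 2 * (1 / (1 - M.γ)) ^ 2 * M.γ ^ n ≤ η)
    (hL : 2 * (Fintype.card S : ℝ) ^ 2 * Fintype.card A * (⌊1 / (1 - M.γ) / η⌋₊ + 1) *
      Real.exp (-L) ≤ δ) :
    1 - δ ≤ (M.sampleLaw N).real {ω | ∀ s a,
      |cvar τ (empiricalKernel ω s a) (maxQ (icvarVI τ M.γ M.r (empiricalKernel ω) n)) -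
        cvar τ (M.prob s a) (maxQ (icvarVI τ M.γ M.r (empiricalKernel ω) n))| ≤
      1 / τ * (2 * l * weightedVar (M.prob s a)
        (maxQ (icvarVI τ M.γ M.r (empiricalKernel ω) n)) + L / (l * N) + 16 * η)} := by
  have hγ := M.γ_nonneg
  have hγ' := M.γ_lt_one
  have hH1 := M.one_le_horizon
  have hpe : ∀ (ω : S × A × Fin N → S) s a s', 0 ≤ empiricalKernel ω s a s' :=
    empiricalKernel_nonneg
  have hse : ∀ (ω : S × A × Fin N → S) s a, ∑ s', empiricalKernel ω s a s' = 1 :=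
    sum_empiricalKernel hN
  set H := 1 / (1 - M.γ) with hH
  set K := ⌊H / η⌋₊ with hK
  let W : (S × A × Fin N → S) → S → A → Fin (K + 1) → S → ℝ := fun ω s a j =>
    maxQ (pinnedVI τ M.γ M.r (empiricalKernel ω) s a (j * η) n)
  have hu : ∀ j : Fin (K + 1), (0 : ℝ) ≤ j * η ∧ j * η ≤ H := by
    intro j
    refine ⟨by positivity, ?_⟩
    have hj : ((j : ℕ) : ℝ) ≤ H / η :=
      (Nat.cast_le.2 (Nat.lt_succ_iff.1 j.2)).trans (Nat.floor_le (by positivity))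
    rwa [le_div_iff₀ hη] at hj
  have hW0 : ∀ ω s a j t, 0 ≤ W ω s a j t := fun ω s a j t => maxQ_nonneg (fun s' a' =>
    (pinnedVI_mem h0 h1 hγ hγ' M.r_nonneg M.r_le_one (hpe ω) (hse ω) s a (hu j).1 (hu j).2 n
      s' a').1) t
  have hW1 : ∀ ω s a j t, W ω s a j t ≤ H := fun ω s a j t => maxQ_le fun a' =>
    (pinnedVI_mem h0 h1 hγ hγ' M.r_nonneg M.r_le_one (hpe ω) (hse ω) s a (hu j).1 (hu j).2 n
      t a').2
  let σ : Bool → ℝ := fun b => if b then 1 else -1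
  -- The index lists a pair, a threshold state, a grid point and a sign; the sign gives both tails.
  let g : S × A × S × Fin (K + 1) × Bool → (S × A × Fin N → S) → S → ℝ := fun k ω t =>
    σ k.2.2.2.2 * max (W ω k.1 k.2.1 k.2.2.2.1 k.2.2.1 - W ω k.1 k.2.1 k.2.2.2.1 t) 0
  let bad : S × A × S × Fin (K + 1) × Bool → Set (S × A × Fin N → S) := fun k =>
    {ω | l * weightedVar (M.prob k.1 k.2.1) (g k ω) + L / (l * N) ≤
      ∑ t, empiricalKernel ω k.1 k.2.1 t * g k ω t - ∑ t, M.prob k.1 k.2.1 t * g k ω t}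
  have hbad : ∀ k, (M.sampleLaw N).real (bad k) ≤ Real.exp (-L) := by
    rintro ⟨s, a, t, j, b⟩
    refine M.sampleLaw_deviation_le hN s a _ ?_ hl0 ?_ L
    · intro ω ω' h
      have : W ω s a j = W ω' s a j := by
        simp only [W]
        rw [pinnedVI_congr τ M.γ M.r (j * η) (p := empiricalKernel ω)
          (p' := empiricalKernel ω') (fun s' a' hsa => ?_) n]
        funext x
        unfold empiricalKernel
        simp only [h (s', a', _) hsa]
      simp only [g, this]
    · intro ω x
      have hm0 : ∀ y, 0 ≤ max (W ω s a j t - W ω s a j y) 0 := fun y => le_max_right _ _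
      have hm1 : ∀ y, max (W ω s a j t - W ω s a j y) 0 ≤ H := fun y =>
        max_le (by linarith [hW0 ω s a j y, hW1 ω s a j t]) (by linarith)
      have e0 := le_weighted (M.prob_nonneg s a) (M.sum_prob s a) hm0
      have e1 := weighted_le (M.prob_nonneg s a) (M.sum_prob s a) hm1
      have e2 : ∑ y, M.prob s a y * g (s, a, t, j, b) ω y =
          σ b * ∑ y, M.prob s a y * max (W ω s a j t - W ω s a j y) 0 := by
        rw [Finset.mul_sum]
        exact Finset.sum_congr rfl fun y _ => by simp only [g]; ring
      have e3 : |σ b| = 1 := by cases b <;> simp [σ]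
      rw [e2]
      simp only [g]
      rw [← mul_sub, abs_mul, abs_mul, e3, one_mul, abs_of_pos hl0]
      refine le_trans (mul_le_mul_of_nonneg_left ?_ hl0.le) hl1
      rw [abs_le]
      constructor <;> linarith [hm0 x, hm1 x]
  set good := {ω : S × A × Fin N → S | ∀ s a,
      |cvar τ (empiricalKernel ω s a) (maxQ (icvarVI τ M.γ M.r (empiricalKernel ω) n)) -
        cvar τ (M.prob s a) (maxQ (icvarVI τ M.γ M.r (empiricalKernel ω) n))| ≤
      1 / τ * (2 * l * weightedVar (M.prob s a)
        (maxQ (icvarVI τ M.γ M.r (empiricalKernel ω) n)) + L / (l * N) + 16 * η)} with hgood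
  have hcover : Set.univ ⊆ good ∪ ⋃ k, bad k := by
    intro ω _
    by_contra hω
    rw [Set.mem_union, Set.mem_iUnion, not_or, not_exists] at hω
    obtain ⟨hng, hnb⟩ := hω
    refine hng fun s a => ?_
    set V := maxQ (icvarVI τ M.γ M.r (empiricalKernel ω) n) with hV
    have hmem := icvarVI_mem h0 h1 hγ hγ' M.r_nonneg M.r_le_one (hpe ω) (hse ω) n s a
    set x := icvarVI τ M.γ M.r (empiricalKernel ω) n s a with hx
    have hj : ⌊x / η⌋₊ < K + 1 :=
      Nat.lt_succ_of_le (Nat.floor_le_floor (div_le_div_of_nonneg_right hmem.2 hη.le))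
    set j : Fin (K + 1) := ⟨⌊x / η⌋₊, hj⟩ with hjdef
    have hxj : |x - j * η| ≤ η := by
      have a1 := Nat.floor_le (div_nonneg hmem.1 hη.le)
      have a2 := (Nat.lt_floor_add_one (x / η)).le
      rw [le_div_iff₀ hη] at a1
      rw [div_le_iff₀ hη] at a2
      rw [abs_le]
      constructor <;> simp only [hjdef] <;> linarith
    have hclose := abs_icvarVI_sub_pinnedVI_le h0 h1 hγ hγ' M.r_nonneg M.r_le_one (hpe ω) (hse ω)
      s a (hu j).1 (hu j).2 hn hxj
    set U := W ω s a j with hU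
    -- One `η` is the rounding to the grid, the other bounds the truncation term `2 H² γ ^ n`.
    have hVU : ∀ t, |V t - U t| ≤ 2 * η := by
      intro t
      have a1 := maxQ_le_add (fun s' a' => sub_le_iff_le_add'.1 (abs_le.1 (hclose s' a')).2) t
      have a2 := maxQ_le_add (Q := pinnedVI τ M.γ M.r (empiricalKernel ω) s a (j * η) n)
        (Q' := icvarVI τ M.γ M.r (empiricalKernel ω) n)
        (d := η + 2 * (1 / (1 - M.γ)) ^ 2 * M.γ ^ n)
        (fun s' a' => by linarith [(abs_le.1 (hclose s' a')).1]) t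
      rw [abs_le]
      constructor <;> linarith
    refine abs_cvar_sub_cvar_le h0 h1 (M.prob_nonneg s a) (M.sum_prob s a) (hpe ω s a)
      (hse ω s a) V fun t => ?_
    have hdiff : ∀ y, |max (V t - V y) 0 - max (U t - U y) 0| ≤ 4 * η := by
      intro y
      refine (abs_max_sub_max_le_abs _ _ _).trans ?_
      have b1 := abs_le.1 (hVU t)
      have b2 := abs_le.1 (hVU y)
      rw [abs_le]
      constructor <;> linarith
    have hmean : ∀ p : S → ℝ, (∀ y, 0 ≤ p y) → ∑ y, p y = 1 →
        |∑ y, p y * max (V t - V y) 0 - ∑ y, p y * max (U t - U y) 0| ≤ 4 * η := by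
      intro p hp hs
      rw [← Finset.sum_sub_distrib]
      simp_rw [← mul_sub]
      rw [abs_le]
      exact ⟨le_weighted hp hs fun y => (abs_le.1 (hdiff y)).1,
        weighted_le hp hs fun y => (abs_le.1 (hdiff y)).2⟩
    have c1 := abs_le.1 (hmean _ (hpe ω s a) (hse ω s a))
    have c2 := abs_le.1 (hmean _ (M.prob_nonneg s a) (M.sum_prob s a))
    have c3 := weightedVar_shortfall_le (M.prob_nonneg s a) (M.sum_prob s a) hVU (U t)
    have d1 := hnb (s, a, t, j, true)
    have d2 := hnb (s, a, t, j, false)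
    have hneg : weightedVar (M.prob s a) (fun y => -max (U t - U y) 0) =
        weightedVar (M.prob s a) (fun y => max (U t - U y) 0) := by
      unfold weightedVar
      refine Finset.sum_congr rfl fun y _ => ?_
      simp only [mul_neg, Finset.sum_neg_distrib]
      ring
    simp only [bad, g, σ, Set.mem_ofPred_eq, not_le, if_true, Bool.false_eq_true, if_false,
      one_mul, neg_mul, ← hU, hneg, mul_neg, Finset.sum_neg_distrib] at d1 d2
    -- Origin of `16 η`: replacing `V` by `U` costs `4 η` in each of the two means, and the variance
    -- comparison costs `l * 2 * (2 η)² ≤ 8 η`.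
    have c4 := mul_le_mul_of_nonneg_left c3 hl0.le
    have c5 := mul_le_mul_of_nonneg_right hlη hη.le
    rw [abs_le]
    constructor <;> nlinarith
  have h2 : (M.sampleLaw N).real (⋃ k, bad k) ≤ δ := by
    refine (measureReal_iUnion_fintype_le _).trans ?_
    refine (Finset.sum_le_sum fun k _ => hbad k).trans (le_trans (le_of_eq ?_) hL)
    rw [Finset.sum_const, Finset.card_univ, nsmul_eq_mul]
    simp only [Fintype.card_prod, Fintype.card_fin, Fintype.card_bool]
    push_cast
    ring
  have h3 := measureReal_mono (μ := M.sampleLaw N) hcover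
  have h4 := measureReal_union_le (μ := M.sampleLaw N) good (⋃ k, bad k)
  rw [probReal_univ] at h3
  linarith

end MDP

/-! ### From CVaR concentration to the success probability -/

namespace MDP

variable {S A : Type*} [Fintype S] [Fintype A]

theorem value_mem (M : MDP S A) {τ : ℝ} (h0 : 0 < τ) (h1 : τ ≤ 1) (π : S → PMF A) (s : S) :
    0 ≤ M.value τ π s ∧ M.value τ π s ≤ 1 / (1 - M.γ) :=
  ⟨ge_of_tendsto' (M.tendsto_nestedValue h0 h1 π s) fun n => (M.nestedValue_mem h0 h1 π n s).1,
    le_of_tendsto' (M.tendsto_nestedValue h0 h1 π s) fun n => (M.nestedValue_mem h0 h1 π n s).2.2⟩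

theorem isEpsOptimal_of_horizon_le [Nonempty A] (M : MDP S A) {τ ε : ℝ} (h0 : 0 < τ)
    (h1 : τ ≤ 1) (hε : 1 / (1 - M.γ) ≤ ε) (π : S → PMF A) : M.IsEpsOptimal τ ε π := by
  intro s
  have : Nonempty (S → PMF A) := ⟨fun _ => PMF.pure (Classical.arbitrary A)⟩
  have : M.optValue τ s ≤ 1 / (1 - M.γ) := ciSup_le fun π' => (M.value_mem h0 h1 π' s).2
  linarith [(M.value_mem h0 h1 π s).1]

variable [MeasurableSpace S] [DecidableEq S] [Nonempty A]

theorem le_successProb_of_horizon_le (M : MDP S A) {τ ε δ : ℝ} (h0 : 0 < τ) (h1 : τ ≤ 1)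
    (hε : 1 / (1 - M.γ) ≤ ε) (hδ : 0 < δ) (N T : ℕ) : 1 - δ ≤ M.successProb τ ε N T := by
  have : M.successProb τ ε N T = 1 := by
    unfold successProb
    rw [← probReal_univ (μ := M.sampleLaw N)]
    congr 1
    exact Set.eq_univ_of_forall fun ω π _ => M.isEpsOptimal_of_horizon_le h0 h1 hε _
  linarith

variable [MeasurableSingletonClass S]
-- On the concentration event the propagation bound applies, so only a deterministic comparison of
-- `Var_P` with `Var_q` (`hvar`) and the choice of parameters remain.
theorem le_successProb (M : MDP S A) {τ ε δ : ℝ} (h0 : 0 < τ) (h1 : τ ≤ 1) {N T : ℕ}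
    (hN : N ≠ 0) {l η L κ b : ℝ} (hl0 : 0 < l) (hl1 : l * (1 / (1 - M.γ)) ≤ 1) (hη : 0 < η)
    (hlη : l * η ≤ 1)
    (hL : 2 * (Fintype.card S : ℝ) ^ 2 * Fintype.card A * (⌊1 / (1 - M.γ) / η⌋₊ + 1) *
      Real.exp (-L) ≤ δ)
    (hκ : 0 ≤ κ) (hκ' : 4 * κ * (1 / (1 - M.γ)) ≤ 1) (hb : 0 ≤ b)
    (hT : M.γ ^ T * (1 / (1 - M.γ)) ≤ 1)
    (hvar : ∀ s a, ∀ q V : S → ℝ, (∀ s', 0 ≤ q s') → (∀ s', τ * q s' ≤ M.prob s a s') →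
      ∑ s', q s' = 1 → (∀ s, 0 ≤ V s) → (∀ s, V s ≤ 1 / (1 - M.γ)) →
      M.γ * (1 / τ * (2 * l * weightedVar (M.prob s a) V + L / (l * N) + 16 * η)) ≤
        κ * (M.γ * weightedVar q V) + b)
    (hε : 3 * M.γ ^ T * (1 / (1 - M.γ)) ^ 2 + 10 * κ * (1 / (1 - M.γ)) ^ 2 +
      4 * b * (1 / (1 - M.γ)) ≤ ε) :
    1 - δ ≤ M.successProb τ ε N T := by
  have hH1 := M.one_le_horizon
  -- The `T` iterations of the algorithm need not be enough for pinning at accuracy `η`, so the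
  -- reference value uses `T + m + 1` iterations; the policy is still greedy for the `T`-th iterate.
  obtain ⟨m, hm⟩ : ∃ m : ℕ, M.γ ^ m < η / (2 * (1 / (1 - M.γ)) ^ 2) :=
    exists_pow_lt_of_lt_one (by positivity) M.γ_lt_one
  rw [lt_div_iff₀ (by positivity)] at hm
  have hn : 2 * (1 / (1 - M.γ)) ^ 2 * M.γ ^ (T + m + 1) ≤ η := by
    have : M.γ ^ (T + m + 1) ≤ M.γ ^ m :=
      pow_le_pow_of_le_one M.γ_nonneg M.γ_lt_one.le (by omega)
    nlinarith [mul_le_mul_of_nonneg_left this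
      (by positivity : (0 : ℝ) ≤ 2 * (1 / (1 - M.γ)) ^ 2)]
  refine (M.sampleLaw_cvar_error h0 h1 hN (Nat.succ_ne_zero (T + m)) hl0 hl1 hη hlη hn hL).trans
    (measureReal_mono fun ω hω π hπ => ?_)
  have hpe := empiricalKernel_nonneg ω
  have hse := sum_empiricalKernel hN ω
  have hmem := icvarVI_mem h0 h1 M.γ_nonneg M.γ_lt_one M.r_nonneg M.r_le_one hpe hse (T + m + 1)
  refine M.isEpsOptimal_of_cvar_error h0 h1 hpe hse (T' := T + m + 1) (by omega) hκ hκ' hb hT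
    (fun s a q hq0 hqp hqs => ?_) hε hπ
  exact (mul_le_mul_of_nonneg_left (hω s a) M.γ_nonneg).trans
    (hvar s a q _ hq0 hqp hqs (maxQ_nonneg fun s a => (hmem s a).1)
      fun s => maxQ_le fun a => (hmem s a).2)

end MDP

/-! ### Numerical estimates for the horizon and the confidence level -/

/-- With `Y` the argument of the logarithm, `γ ^ T ≤ exp (-(1 - γ) T) ≤ Y⁻⁸`, while `Y ≥ 2 / (1 -
γ)` and `ε Y ≥ 2`. -/
theorem pow_horizon_le {γ ε : ℝ} (hγ : 0 ≤ γ) (hγ' : γ < 1) (hε : 0 < ε) {C : ℝ} (hC : 8 ≤ C)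
    {T : ℕ} (hT : C / (1 - γ) * Real.log (2 * (1 + 1 / ε) / (1 - γ)) ≤ T) :
    γ ^ T * (1 / (1 - γ)) ≤ 1 ∧ 12 * γ ^ T * (1 / (1 - γ)) ^ 2 ≤ ε := by
  have hd : 0 < 1 - γ := by linarith
  set H := 1 / (1 - γ) with hH
  have hH1 : 1 ≤ H := by rw [hH, le_div_iff₀ hd]; linarith
  set Y := 2 * (1 + 1 / ε) / (1 - γ) with hY
  have hYH : Y = 2 * (1 + 1 / ε) * H := by rw [hY, hH]; ring
  have hε' : 0 < 1 / ε := by positivity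
  have hY1 : 2 * H ≤ Y := by rw [hYH]; nlinarith
  have hY2 : 2 ≤ ε * Y := by
    have : ε * Y = 2 * (ε + 1) * H := by rw [hYH]; field_simp
    rw [this]; nlinarith
  have hY0 : 0 < Y := by linarith
  have hlog : 0 ≤ Real.log Y := Real.log_nonneg (by linarith)
  have h1 : γ ^ T * Y ^ 8 ≤ 1 := by
    have e1 : γ ^ T ≤ Real.exp (-(1 - γ) * T) := by
      rw [mul_comm, Real.exp_nat_mul]
      exact pow_le_pow_left₀ hγ (by linarith [Real.add_one_le_exp (-(1 - γ))]) T
    have e2 : Y ^ 8 = Real.exp (8 * Real.log Y) := by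
      rw [mul_comm, Real.exp_mul, Real.exp_log hY0]; norm_cast
    have e3 : 8 * Real.log Y ≤ (1 - γ) * T := by
      have := mul_le_mul_of_nonneg_left hT hd.le
      have e : (1 - γ) * (C / (1 - γ) * Real.log Y) = C * Real.log Y := by field_simp
      nlinarith
    calc γ ^ T * Y ^ 8 ≤ Real.exp (-(1 - γ) * T) * Real.exp (8 * Real.log Y) := by
          rw [← e2]; gcongr
      _ ≤ 1 := by rw [← Real.exp_add, Real.exp_le_one_iff]; linarith
  have hg : 0 ≤ γ ^ T := pow_nonneg hγ T
  have hY2' : 2 ≤ Y := by linarith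
  constructor
  · have : H ≤ Y ^ 8 := by
      have : Y ≤ Y ^ 8 := le_self_pow₀ (by linarith) (by norm_num)
      linarith
    nlinarith [mul_le_mul_of_nonneg_left this hg]
  · have a1 : (2 * H) ^ 2 ≤ Y ^ 2 := pow_le_pow_left₀ (by linarith) hY1 2
    have a2 : (2 : ℝ) ^ 5 ≤ Y ^ 5 := pow_le_pow_left₀ (by norm_num) hY2' 5
    have a3 : 12 * H ^ 2 ≤ ε * Y ^ 8 := by
      calc 12 * H ^ 2 ≤ 2 * ((2 * H) ^ 2 * 2 ^ 5) := by nlinarith [sq_nonneg H]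
        _ ≤ (ε * Y) * (Y ^ 2 * Y ^ 5) := by gcongr
        _ = _ := by ring
    calc 12 * γ ^ T * H ^ 2 = γ ^ T * (12 * H ^ 2) := by ring
      _ ≤ γ ^ T * (ε * Y ^ 8) := by gcongr
      _ = ε * (γ ^ T * Y ^ 8) := by ring
      _ ≤ ε := mul_le_of_le_one_right hε.le h1

/-- The logarithm of the number of events in the union bound is of the order of the logarithm in
the sample complexity. -/
theorem log_union_le {n m d ε ρ δ k : ℝ} (hn : 1 ≤ n) (hm : 1 ≤ m) (hd : 0 < d) (hd' : d ≤ 1)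
    (hε : 0 < ε) (hρ : 0 < ρ) (hρ' : ρ ≤ 1) (hδ : 0 < δ) (hδ' : δ < 1) (hk : 0 < k)
    (hk' : k ≤ 2048 * ((1 + 1 / ε) / (ρ * d ^ 2))) :
    Real.log (2 * n ^ 2 * m * k / δ) ≤ 13 * Real.log (2 * n * m * (1 + 1 / ε) / (ρ * d * δ)) ∧
      0 < Real.log (2 * n * m * (1 + 1 / ε) / (ρ * d * δ)) := by
  set E := 1 + 1 / ε with hE
  have hE1 : 1 ≤ E := by have : 0 < 1 / ε := by positivity
                         linarith
  set X := 2 * n * m * E / (ρ * d * δ) with hX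
  have hX2 : 2 ≤ X := by
    rw [hX, le_div_iff₀ (by positivity)]
    have h1 : ρ * d * δ ≤ 1 := mul_le_one₀ (mul_le_one₀ hρ' hd.le hd') hδ.le hδ'.le
    have h2 : 1 ≤ n * m * E := one_le_mul_of_one_le_of_one_le
      (one_le_mul_of_one_le_of_one_le hn hm) hE1
    nlinarith
  refine ⟨?_, Real.log_pos (by linarith)⟩
  -- Two factors of `X` cover the parameters; the other eleven absorb `2048 = 2 ^ 11`, as `X ≥ 2`.
  have hle : 2 * n ^ 2 * m * k / δ ≤ X ^ 13 := by
    have h1 : 2 * n ^ 2 * m * k / δ ≤ 2 ^ 11 * X ^ 2 := by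
      calc 2 * n ^ 2 * m * k / δ ≤ 2 * n ^ 2 * m * (2048 * (E / (ρ * d ^ 2))) / δ := by gcongr
        _ = 2 ^ 11 * X ^ 2 * (ρ * δ / (2 * m * E)) := by
            rw [hX]; field_simp; ring
        _ ≤ 2 ^ 11 * X ^ 2 * 1 := by
            gcongr
            rw [div_le_one (by positivity)]
            have h1 : ρ * δ ≤ 1 := mul_le_one₀ hρ' hδ.le hδ'.le
            have h2 : 1 ≤ m * E := one_le_mul_of_one_le_of_one_le hm hE1
            linarith
        _ = _ := mul_one _
    calc _ ≤ 2 ^ 11 * X ^ 2 := h1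
      _ ≤ X ^ 11 * X ^ 2 := by gcongr
      _ = X ^ 13 := by ring
  have : Real.log (2 * n ^ 2 * m * k / δ) ≤ Real.log (X ^ 13) :=
    Real.log_le_log (by positivity) hle
  rwa [Real.log_pow] at this

namespace MDP

variable {S A : Type*} [Fintype S] [Fintype A] [Nonempty S] [Nonempty A]

/-- The two regimes of the sample complexity bound share the choice of the grid and of the
confidence level. -/
theorem exists_confidence_level (M : MDP S A) {ε ρ δ c : ℝ} (hε : 0 < ε)
    (hρ : 0 < ρ) (hρ' : ρ ≤ 1) (hδ : 0 < δ) (hδ' : δ < 1) {N : ℕ} (hc : 0 < c)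
    (hN : 100000 * (Fintype.card S * Fintype.card A / c) *
      Real.log (2 * Fintype.card S * Fintype.card A * (1 + 1 / ε) / (ρ * (1 - M.γ) * δ))
        ≤ M.numSamples N) :
    ∃ L : ℝ, N ≠ 0 ∧ 7000 * L ≤ c * N ∧ 2 * (Fintype.card S : ℝ) ^ 2 * Fintype.card A *
      (⌊1 / (1 - M.γ) / (ε * ρ * (1 - M.γ) / 1280)⌋₊ + 1) * Real.exp (-L) ≤ δ ∧ 0 ≤ L := by
  have hd : 0 < 1 - M.γ := by linarith [M.γ_lt_one]
  have hd' : 1 - M.γ ≤ 1 := by linarith [M.γ_nonneg]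
  set d := 1 - M.γ with hddef
  have hn : (1 : ℝ) ≤ Fintype.card S := Nat.one_le_cast.2 Fintype.card_pos
  have hm : (1 : ℝ) ≤ Fintype.card A := Nat.one_le_cast.2 Fintype.card_pos
  set n : ℝ := ((Fintype.card S : ℕ) : ℝ) with hndef
  set m : ℝ := ((Fintype.card A : ℕ) : ℝ) with hmdef
  set k : ℝ := ⌊1 / d / (ε * ρ * d / 1280)⌋₊ + 1 with hk
  have hk1 : 1 ≤ k := by
    have : (0 : ℝ) ≤ (⌊1 / d / (ε * ρ * d / 1280)⌋₊ : ℝ) := Nat.cast_nonneg _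
    linarith
  have hk2 : k ≤ 2048 * ((1 + 1 / ε) / (ρ * d ^ 2)) := by
    have h1 := Nat.floor_le (by positivity : 0 ≤ 1 / d / (ε * ρ * d / 1280))
    have h2 : 1 / d / (ε * ρ * d / 1280) = 1280 * (1 / ε / (ρ * d ^ 2)) := by field_simp
    have h3 : 1 ≤ 1 / (ρ * d ^ 2) := by
      rw [le_div_iff₀ (by positivity), one_mul]
      exact mul_le_one₀ hρ' (by positivity) (pow_le_one₀ hd.le hd')
    have h4 : 0 ≤ 1 / ε / (ρ * d ^ 2) := by positivity
    rw [add_div]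
    linarith
  obtain ⟨hlog, hpos⟩ := log_union_le hn hm hd hd' hε hρ hρ' hδ hδ' (by linarith) hk2
  set l := Real.log (2 * n * m * (1 + 1 / ε) / (ρ * d * δ)) with hl
  have hN' : 100000 * l ≤ c * N := by
    have e : ((M.numSamples N : ℕ) : ℝ) = n * m * N := by
      unfold numSamples; push_cast; rfl
    rw [e] at hN
    have hnm : 0 < n * m := by positivity
    have e2 : 100000 * (n * m / c) * l = n * m * (100000 * l / c) := by ring
    rw [e2] at hN
    have := le_of_mul_le_mul_left hN hnm
    rw [div_le_iff₀ hc] at this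
    linarith
  -- This `L` makes the union bound equal to `δ`. It is at most 13 times the given logarithm, and
  -- `13 * 7000 ≤ 100000`.
  refine ⟨Real.log (2 * n ^ 2 * m * k / δ), ?_, by linarith, ?_, ?_⟩
  · rintro rfl
    simp only [Nat.cast_zero, mul_zero] at hN'
    linarith
  · rw [Real.exp_neg, Real.exp_log (by positivity)]
    apply le_of_eq
    field_simp
  · refine Real.log_nonneg ?_
    rw [le_div_iff₀ hδ]
    have h1 : 1 ≤ n ^ 2 * m := one_le_mul_of_one_le_of_one_le (one_le_pow₀ hn) hm
    have h2 : 1 ≤ n ^ 2 * m * k := one_le_mul_of_one_le_of_one_le h1 hk1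
    linarith

end MDP

/-! ### The sample complexity bound in both regimes -/

theorem theorem1 :
    ∃ C : ℝ, 0 < C ∧
      ∀ (S A : Type*) [Fintype S] [DecidableEq S] [Nonempty S] [MeasurableSpace S]
        [MeasurableSingletonClass S] [Fintype A] [Nonempty A]
        (M : MDP S A) (τ ε δ : ℝ), 0 < τ → τ ≤ 1 → 0 < ε → 0 < δ → δ < 1 →
      ∀ N T : ℕ, C / (1 - M.γ) * Real.log (2 * (1 + 1 / ε) / (1 - M.γ)) ≤ T →
        (C * (Fintype.card S * Fintype.card A / (τ ^ 2 * (1 - M.γ) ^ 4 * ε ^ 2)) *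
            Real.log (2 * Fintype.card S * Fintype.card A * (1 + 1 / ε) / (τ * (1 - M.γ) * δ))
              ≤ M.numSamples N →
          1 - δ ≤ M.successProb τ ε N T) ∧
        (M.γ ≤ τ →
          C * (Fintype.card S * Fintype.card A / ((1 - M.γ) ^ 3 * ε ^ 2)) *
            Real.log (2 * Fintype.card S * Fintype.card A * (1 + 1 / ε) / ((1 - M.γ) * δ))
              ≤ M.numSamples N →
          1 - δ ≤ M.successProb τ ε N T) := by
  refine ⟨100000, by norm_num, ?_⟩
  intro S A _ _ _ _ _ _ _ M τ ε δ h0 h1 hε hδ hδ' N T hT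
  have hγ := M.γ_nonneg
  have hγ' := M.γ_lt_one
  obtain ⟨hT1, hT2⟩ := pow_horizon_le hγ hγ' hε (by norm_num) hT
  have hH1 := M.one_le_horizon
  -- If `ε` exceeds the horizon every policy is `ε`-optimal; otherwise `ε (1 - γ) ≤ 1`, which makes
  -- the chosen `l` and `κ` admissible.
  rcases le_total (1 / (1 - M.γ)) ε with hεH | hεH
  · exact ⟨fun _ => M.le_successProb_of_horizon_le h0 h1 hεH hδ N T,
      fun _ _ => M.le_successProb_of_horizon_le h0 h1 hεH hδ N T⟩
  have hd : 0 < 1 - M.γ := by linarith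
  have hd' : 1 - M.γ ≤ 1 := by linarith
  set d := 1 - M.γ with hddef
  have hεd : ε * d ≤ 1 := by rwa [le_div_iff₀ hd] at hεH
  have hεd0 : 0 < ε * d := by positivity
  constructor
  · intro hN
    obtain ⟨L, hN0, hNL, hL, hL0⟩ :=
      M.exists_confidence_level hε h0 h1 hδ hδ' (by positivity) hN
    have hN' : (0 : ℝ) < N := by positivity
    have hετ : ε * d * τ ≤ 1 := mul_le_one₀ hεd h0.le h1
    have hLN : L / (ε * τ * d ^ 3 / 96 * N) ≤ ε * τ * d / 48 := by
      rw [div_le_iff₀ (by positivity)]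
      have : ε * τ * d / 48 * (ε * τ * d ^ 3 / 96 * N) =
        (τ ^ 2 * d ^ 4 * ε ^ 2) * N / 4608 := by ring
      rw [this, le_div_iff₀ (by norm_num)]
      linarith
    -- No telescoping: `l` is such that `2 l H² = ε τ d / 48`, matching the bound on `L / (l N)`.
    -- The iteration error and `4 b H` each contribute at most `ε / 4`.
    refine M.le_successProb h0 h1 hN0 (l := ε * τ * d ^ 3 / 96) (κ := 0) (b := ε * d / 16)
      (by positivity) ?_ (by positivity) ?_ hL le_rfl (by norm_num) (by positivity) hT1 ?_ ?_
    · have : ε * τ * d ^ 3 / 96 * (1 / d) = (ε * d * τ) * d / 96 := by field_simp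
      rw [this]
      have := mul_le_one₀ hετ hd.le hd'
      linarith
    · have : ε * τ * d ^ 3 / 96 * (ε * τ * d / 1280) =
        (ε * d * τ) * (ε * d * τ) * d ^ 2 / 122880 := by ring
      rw [this]
      have := mul_le_one₀ (mul_le_one₀ hετ (by positivity) hετ) (by positivity)
        (pow_le_one₀ hd.le hd' (n := 2))
      linarith
    · intro s a q V _ _ _ hV0 hV1
      have hvar := weightedVar_le_sq (M.prob_nonneg s a) (M.sum_prob s a) hV0 hV1
      have e1 := mul_le_mul_of_nonneg_left hvar
        (by positivity : 0 ≤ 2 * (ε * τ * d ^ 3 / 96))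
      have e2 : 2 * (ε * τ * d ^ 3 / 96) * (1 / d) ^ 2 = ε * τ * d / 48 := by field_simp; ring
      rw [e2] at e1
      have e3 : 2 * (ε * τ * d ^ 3 / 96) * weightedVar (M.prob s a) V +
          L / (ε * τ * d ^ 3 / 96 * N) + 16 * (ε * τ * d / 1280) ≤ τ * (ε * d / 16) := by
        have : 0 ≤ ε * τ * d := by positivity
        linarith
      have e4 : 1 / τ * (2 * (ε * τ * d ^ 3 / 96) * weightedVar (M.prob s a) V +
          L / (ε * τ * d ^ 3 / 96 * N) + 16 * (ε * τ * d / 1280)) ≤ ε * d / 16 := by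
        rw [one_div, ← div_eq_inv_mul, div_le_iff₀ h0]; linarith
      have e5 := mul_le_mul_of_nonneg_left e4 hγ
      have e6 : M.γ * (ε * d / 16) ≤ 1 * (ε * d / 16) := by gcongr
      linarith
    · have : 4 * (ε * d / 16) * (1 / d) = ε / 4 := by field_simp; ring
      rw [this]
      linarith
  · intro hγτ hN
    -- This regime uses the grid parameter `ρ = 1` in place of `τ`.
    rw [← one_mul (d * δ), ← mul_assoc 1 d δ] at hN
    obtain ⟨L, hN0, hNL, hL, hL0⟩ :=
      M.exists_confidence_level hε one_pos le_rfl hδ hδ' (by positivity) hN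
    have hN' : (0 : ℝ) < N := by positivity
    have hLN : L / (ε * d ^ 2 / 80 * N) ≤ ε * d / 80 := by
      rw [div_le_iff₀ (by positivity)]
      have : ε * d / 80 * (ε * d ^ 2 / 80 * N) = (d ^ 3 * ε ^ 2) * N / 6400 := by ring
      rw [this, le_div_iff₀ (by norm_num)]
      linarith
    have hεd2 : ε * d * d ≤ 1 := mul_le_one₀ hεd hd.le hd'
    -- Here `κ = 2 l`, because `γ / τ` times `Var_P(V)` is at most `γ Var_q(V) + H`; the extra `κ H
    -- = ε d / 40` goes into `b`. Each of `10 κ H²`, `4 b H` and the iteration error is at most `ε /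
    -- 4`.
    refine M.le_successProb h0 h1 hN0 (l := ε * d ^ 2 / 80) (κ := ε * d ^ 2 / 40)
      (b := ε * d / 16) (by positivity) ?_ (by positivity) ?_ hL (by positivity) ?_
      (by positivity) hT1 ?_ ?_
    · have : ε * d ^ 2 / 80 * (1 / d) = ε * d / 80 := by field_simp
      rw [this]
      linarith
    · have : ε * d ^ 2 / 80 * (ε * 1 * d / 1280) = (ε * d) * (ε * d) * d / 102400 := by ring
      rw [this]
      have := mul_le_one₀ (mul_le_one₀ hεd hεd0.le hεd) hd.le hd'
      linarith
    · have : 4 * (ε * d ^ 2 / 40) * (1 / d) = ε * d / 10 := by field_simp; ring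
      rw [this]
      linarith
    · intro s a q V hq0 hqp hqs hV0 hV1
      have hvar := weightedVar_le_of_dominated (M.sum_prob s a) hq0 hqp hqs hV0 hV1
      set v := weightedVar (M.prob s a) V
      set w := weightedVar q V
      have hγτ1 : M.γ * (1 / τ) ≤ 1 := by
        rw [mul_one_div, div_le_one h0]; exact hγτ
      have hγτ0 : 0 ≤ M.γ * (1 / τ) := by positivity
      -- The hypothesis `τ ≥ γ` enters here through `1 - τ ≤ 1 - γ`: the mass that `q` leaves out
      -- costs only `H` instead of `H²`.
      have hres : (1 - τ) * (1 / d) ^ 2 ≤ 1 / d := by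
        calc (1 - τ) * (1 / d) ^ 2 ≤ d * (1 / d) ^ 2 := by gcongr; linarith
          _ = 1 / d := by field_simp
      have e1 : M.γ * (1 / τ) * v ≤ M.γ * w + 1 / d := by
        calc M.γ * (1 / τ) * v ≤ M.γ * (1 / τ) * (τ * w + 1 / d) := by gcongr; linarith
          _ = M.γ * w + M.γ * (1 / τ) * (1 / d) := by field_simp
          _ ≤ M.γ * w + 1 * (1 / d) := by gcongr
          _ = _ := by rw [one_mul]
      have e2 := mul_le_mul_of_nonneg_left e1 (by positivity : 0 ≤ ε * d ^ 2 / 40)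
      have e3 : ε * d ^ 2 / 40 * (1 / d) = ε * d / 40 := by field_simp
      have e4 : M.γ * (1 / τ) * (L / (ε * d ^ 2 / 80 * N) + 16 * (ε * 1 * d / 1280)) ≤
          1 * (ε * d / 40) := by
        refine mul_le_mul hγτ1 (by linarith) ?_ one_pos.le
        positivity
      nlinarith
    · have e1 : 4 * (ε * d / 16) * (1 / d) = ε / 4 := by field_simp; ring
      have e2 : 10 * (ε * d ^ 2 / 40) * (1 / d) ^ 2 = ε / 4 := by field_simp; ring
      rw [e1, e2]
      linarith
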